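/- Let $\mathfrak g$ be a seven-dimensional real almost-abelian Lie algebra, i.e. $\mathfrak g$ has an abelian ideal $\mathfrak h$ of dimension $6$, and let $\varphi_0\in\Lambda^3\mathfrak g^*$ be a $G_2$-structure, with induced metric $g_0$, orientation and Hodge star $\star_0$; that is, in some oriented $g_0$-orthonormal coframe (an adapted frame) $$\varphi_0=e^{127}+e^{347}+e^{567}+e^{135}-e^{146}-e^{236}-e^{245}.$$ Put $\phi_0=\star_0\varphi_0$ and assume that $\varphi_0$ is coclosed, $d\phi_0=0$, where $d$ is the Chevalley–Eilenberg differential. Let $e_7$ be a $g_0$-unit vector orthogonal to $\mathfrak h$, let $A=\mathrm{ad}_{e_7}|_{\mathfrak h}$, and let $\omega_0=(e_7\lrcorner\varphi_0)|_{\mathfrak h}$, $\psi_0=-(e_7\lrcorner\phi_0)|_{\mathfrak h}$ be the induced $SU(3)$-structure on $\mathfrak h$. For an endomorphism $E$ and a $k$-form $\alpha$ write $(\vartheta(E)\alpha)(v_1,\dots,v_k)=-\sum_i\alpha(v_1,\dots,Ev_i,\dots,v_k)$, and let $\Delta_0=dd^*+d^*d$ be the Hodge Laplacian of $g_0$ on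 the forms on $\mathfrak g$. Suppose that $\phi_0$ is a soliton of the Laplacian coflow, i.e. $-\Delta_0\phi_0=-4c\,\phi_0+\vartheta(D)\phi_0$ for some $c\in\mathbb R$ and some derivation $D$ of $\mathfrak g$, and that $\phi_0$ is an eigenform of the Laplacian, i.e. $\Delta_0\phi_0=\lambda\phi_0$ for some $\lambda\in\mathbb R$. Then $\phi_0$ is harmonic, $\Delta_0\phi_0=0$, and $A$ belongs to the Lie algebra $\mathfrak{su}(\mathfrak h,\omega_0,\psi_0)\cong\mathfrak{su}(3)$ of the stabiliser of $(\omega_0,\psi_0)$: $A$ is skew-symmetric with respect to $g_0|_{\mathfrak h}$, $\vartheta(A)\omega_0=0$ and $\vartheta(A)\psi_0=0$. -/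

import Mathlib

namespace G2Coflow

noncomputable section

/-! ### Exterior forms on a real vector space -/

section Forms

variable {V : Type*} [AddCommGroup V] [Module ℝ V]

/-- The derivation action of an endomorphism on `k`-forms:
`(ϑ(A)α)(v₁, …, v_k) = - ∑ i, α(v₁, …, A vᵢ, …, v_k)`. In particular `ϑ(c Id)α = -k c α`. -/
def formAction {k : ℕ} (A : Module.End ℝ V) (α : V [⋀^Fin k]→ₗ[ℝ] ℝ) :
    V [⋀^Fin k]→ₗ[ℝ] ℝ where
  toFun v := -∑ i, α (Function.update v i (A (v i)))
  map_update_add' {inst} v j x y := by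
    obtain rfl : inst = instDecidableEqFin k := Subsingleton.elim _ _
    rw [← neg_add, ← Finset.sum_add_distrib]
    congr 1
    refine Finset.sum_congr rfl fun i _ => ?_
    by_cases h : i = j
    · subst h
      simp
    · simp only [Function.update_of_ne h]
      rw [Function.update_comm (Ne.symm h), Function.update_comm (Ne.symm h),
        Function.update_comm (Ne.symm h)]
      exact α.map_update_add _ _ _ _
  map_update_smul' {inst} v j c x := by
    obtain rfl : inst = instDecidableEqFin k := Subsingleton.elim _ _
    rw [smul_neg, Finset.smul_sum]
    congr 1
    refine Finset.sum_congr rfl fun i _ => ?_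
    by_cases h : i = j
    · subst h
      simp
    · simp only [Function.update_of_ne h]
      rw [Function.update_comm (Ne.symm h), Function.update_comm (Ne.symm h)]
      exact α.map_update_smul _ _ _ _
  map_eq_zero_of_eq' v i j hv hij := by
    rw [neg_eq_zero]
    have hz : ∀ l, l ≠ i ∧ l ≠ j → α (Function.update v l (A (v l))) = 0 := by
      rintro l ⟨hli, hlj⟩
      refine α.map_eq_zero_of_eq _ ?_ hij
      rw [Function.update_of_ne (Ne.symm hli), Function.update_of_ne (Ne.symm hlj), hv]
    rw [Fintype.sum_eq_add i j hij hz]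
    have hs : Function.update v j (A (v j))
        = Function.update v i (A (v i)) ∘ Equiv.swap i j := by
      funext l
      rcases eq_or_ne l i with rfl | hli
      · simp [Function.update_of_ne hij, Function.update_of_ne hij.symm, hv]
      · rcases eq_or_ne l j with rfl | hlj
        · simp [hv]
        · simp [Equiv.swap_apply_of_ne_of_ne hli hlj, hli, hlj]
    rw [hs, α.map_swap _ hij]
    simp

/-- The contraction `x ⌟ α = α(x, ·, …, ·)`. -/
def contraction {k : ℕ} (x : V) (α : V [⋀^Fin (k + 1)]→ₗ[ℝ] ℝ) : V [⋀^Fin k]→ₗ[ℝ] ℝ :=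
  α.curryLeft x

/-- The decomposable 3-form `eⁱ ∧ eʲ ∧ eᵏ` of the coframe dual to the basis `e`
(the index `0` stands for the first vector `e₁`, the index `6` for the last vector `e₇`). -/
def coframe3 (e : Module.Basis (Fin 7) ℝ V) (i j k : Fin 7) : V [⋀^Fin 3]→ₗ[ℝ] ℝ :=
  (Matrix.detRowAlternating (R := ℝ) (n := Fin 3)).compLinearMap
    (LinearMap.pi fun a => e.coord (![i, j, k] a))

/-- The model 3-form
`e¹²⁷ + e³⁴⁷ + e⁵⁶⁷ + e¹³⁵ - e¹⁴⁶ - e²³⁶ - e²⁴⁵` in the coframe dual to `e`. -/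
def modelForm (e : Module.Basis (Fin 7) ℝ V) : V [⋀^Fin 3]→ₗ[ℝ] ℝ :=
  coframe3 e 0 1 6 + coframe3 e 2 3 6 + coframe3 e 4 5 6 + coframe3 e 0 2 4
    - coframe3 e 0 3 5 - coframe3 e 1 2 5 - coframe3 e 1 3 4

/-- `e` is an adapted frame of the 3-form `φ`. A 3-form on a seven-dimensional space is a
(linear) `G₂`-structure (a positive 3-form) exactly when it has an adapted frame. The metric and
the orientation of a `G₂`-structure are those for which one (equivalently, every) adapted frame
is orthonormal and positively oriented. -/
def IsAdaptedFrame (φ : V [⋀^Fin 3]→ₗ[ℝ] ℝ) (e : Module.Basis (Fin 7) ℝ V) : Prop :=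
  φ = modelForm e

/-- The inner product for which the basis `e` is orthonormal. -/
def frameInner (e : Module.Basis (Fin 7) ℝ V) (x y : V) : ℝ :=
  ∑ i, e.coord i x * e.coord i y

/-- Insertion of vectors into the first `k` slots: `(w₁, …, w_m) ↦ β(a₁, …, a_k, w₁, …, w_m)`. -/
def insertVectors {k m n : ℕ} (h : k + m = n) (β : V [⋀^Fin n]→ₗ[ℝ] ℝ) (a : Fin k → V) :
    V [⋀^Fin m]→ₗ[ℝ] ℝ where
  toFun w := β (Fin.append a w ∘ Fin.cast h.symm)
  map_update_add' {inst} w j x y := by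
    obtain rfl : inst = instDecidableEqFin m := Subsingleton.elim _ _
    subst h
    have hu : ∀ z, Fin.append a (Function.update w j z) ∘ Fin.cast rfl
        = Function.update (Fin.append a w) (Fin.natAdd k j) z := by
      intro z
      funext l
      refine Fin.addCases (fun l => ?_) (fun l => ?_) l
      · have : Fin.castAdd m l ≠ Fin.natAdd k j := by
          simp only [ne_eq, Fin.ext_iff, Fin.val_castAdd, Fin.val_natAdd]
          omega
        simp [Function.update_of_ne this]
      · by_cases hl : l = j
        · subst hl
          simp
        · have : Fin.natAdd k l ≠ Fin.natAdd k j := by simpa using hl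
          simp [Function.update_of_ne this, Function.update_of_ne hl]
    simp only [hu]
    exact β.map_update_add _ _ _ _
  map_update_smul' {inst} w j c x := by
    obtain rfl : inst = instDecidableEqFin m := Subsingleton.elim _ _
    subst h
    have hu : ∀ z, Fin.append a (Function.update w j z) ∘ Fin.cast rfl
        = Function.update (Fin.append a w) (Fin.natAdd k j) z := by
      intro z
      funext l
      refine Fin.addCases (fun l => ?_) (fun l => ?_) l
      · have : Fin.castAdd m l ≠ Fin.natAdd k j := by
          simp only [ne_eq, Fin.ext_iff, Fin.val_castAdd, Fin.val_natAdd]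
          omega
        simp [Function.update_of_ne this]
      · by_cases hl : l = j
        · subst hl
          simp
        · have : Fin.natAdd k l ≠ Fin.natAdd k j := by simpa using hl
          simp [Function.update_of_ne this, Function.update_of_ne hl]
    simp only [hu]
    exact β.map_update_smul _ _ _ _
  map_eq_zero_of_eq' w i j hw hij := by
    refine β.map_eq_zero_of_eq (i := Fin.cast h (Fin.natAdd k i))
      (j := Fin.cast h (Fin.natAdd k j)) _ (by simpa using hw) ?_
    simpa [Fin.ext_iff] using hij

/-- The Hodge star operator on `k`-forms, `k + m = 7`, of the metric and the orientation for which
`e` is an oriented orthonormal basis. With `vol = e¹ ∧ … ∧ e⁷`,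
`(⋆α)(w₁, …, w_m) = (1/k!) ∑ α(e_{i₁}, …, e_{i_k}) vol(e_{i₁}, …, e_{i_k}, w₁, …, w_m)`,
the sum being over all `i₁, …, i_k`; this is the operator with `α ∧ ⋆β = ⟨α, β⟩ vol`. -/
def hodgeStar (e : Module.Basis (Fin 7) ℝ V) {k m : ℕ} (h : k + m = 7)
    (α : V [⋀^Fin k]→ₗ[ℝ] ℝ) : V [⋀^Fin m]→ₗ[ℝ] ℝ :=
  (1 / (k.factorial : ℝ)) • ∑ i : Fin k → Fin 7, α (e ∘ i) • insertVectors h e.det (e ∘ i)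

end Forms

/-! ### Left-invariant forms: exterior derivative and Laplacian on a Lie algebra -/

section LieAlgebraForms

variable {g : Type*} [LieRing g] [LieAlgebra ℝ g]

/-- The map `x ↦ ϑ(ad x)α`, that is, the Lie derivative of the left-invariant form `α` along the
left-invariant vector field `x`. -/
def lieDerivForm {k : ℕ} (α : g [⋀^Fin k]→ₗ[ℝ] ℝ) : g →ₗ[ℝ] g [⋀^Fin k]→ₗ[ℝ] ℝ where
  toFun x := formAction (LieAlgebra.ad ℝ g x) α
  map_add' x y := by
    ext v
    simp only [formAction, AlternatingMap.coe_mk, MultilinearMap.coe_mk, AlternatingMap.add_apply,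
      map_add, LinearMap.add_apply, AlternatingMap.map_update_add, Finset.sum_add_distrib, neg_add]
  map_smul' c x := by
    ext v
    simp only [formAction, AlternatingMap.coe_mk, MultilinearMap.coe_mk, AlternatingMap.smul_apply,
      map_smul, LinearMap.smul_apply, AlternatingMap.map_update_smul, RingHom.id_apply, smul_neg,
      Finset.smul_sum]

/-- The Chevalley-Eilenberg differential, that is, the exterior derivative of left-invariant forms:
`(dα)(v₀, …, v_k) = ∑_{i<j} (-1)^(i+j) α([vᵢ, vⱼ], v₀, …, v̂ᵢ, …, v̂ⱼ, …, v_k)`.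
It is written here as `dα = (1/2) ∑ eⁱ ∧ ϑ(ad eᵢ)α`, that is, as
`(1/2) ∑ᵢ (-1)^i (ϑ(ad vᵢ)α)(v₀, …, v̂ᵢ, …, v_k)`, where each pair of indices occurs twice. -/
def extD {k : ℕ} (α : g [⋀^Fin k]→ₗ[ℝ] ℝ) : g [⋀^Fin (k + 1)]→ₗ[ℝ] ℝ :=
  (1 / 2 : ℝ) • AlternatingMap.alternatizeUncurryFin (lieDerivForm α)

/-- The codifferential `d* = (-1)^(p+1) ⋆ d ⋆` on `(p+1)`-forms in dimension seven. -/
def codiff (e : Module.Basis (Fin 7) ℝ g) {p m : ℕ} (h : p + 1 + m = 7)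
    (α : g [⋀^Fin (p + 1)]→ₗ[ℝ] ℝ) : g [⋀^Fin p]→ₗ[ℝ] ℝ :=
  (-1 : ℝ) ^ (p + 1) • hodgeStar e (show m + 1 + p = 7 by omega) (extD (hodgeStar e h α))

/-- The Hodge Laplacian `Δ = d d* + d* d` on 4-forms. -/
def laplacian4 (e : Module.Basis (Fin 7) ℝ g) (α : g [⋀^Fin 4]→ₗ[ℝ] ℝ) :
    g [⋀^Fin 4]→ₗ[ℝ] ℝ :=
  extD (codiff e (p := 3) (m := 3) rfl α) + codiff e (p := 4) (m := 2) rfl (extD α)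

/-- The 4-form `ϕ = ⋆φ` is a soliton of the Laplacian coflow:
`-Δϕ = -4cϕ + ϑ(D)ϕ` for a real number `c` and a derivation `D` of the Lie algebra. -/
def IsCoflowSoliton (e : Module.Basis (Fin 7) ℝ g) (ϕ : g [⋀^Fin 4]→ₗ[ℝ] ℝ) : Prop :=
  ∃ (c : ℝ) (D : LieDerivation ℝ g g),
    -laplacian4 e ϕ = (-4 * c) • ϕ + formAction (D : g →ₗ[ℝ] g) ϕ

/-- `ϕ` is an eigenform of the Laplacian (real eigenvalue, zero allowed). -/
def IsLaplacianEigenform (e : Module.Basis (Fin 7) ℝ g) (ϕ : g [⋀^Fin 4]→ₗ[ℝ] ℝ) : Prop :=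
  ϕ ≠ 0 ∧ ∃ l : ℝ, laplacian4 e ϕ = l • ϕ

end LieAlgebraForms

/-! ### The induced `SU(3)`-structure on a codimension-one ideal -/

section SU3

variable {g : Type*} [LieRing g] [LieAlgebra ℝ g]

/-- The restriction of a form to an ideal. -/
def restrictForm {k : ℕ} (h : LieIdeal ℝ g) (α : g [⋀^Fin k]→ₗ[ℝ] ℝ) : h [⋀^Fin k]→ₗ[ℝ] ℝ :=
  α.compLinearMap (h : Submodule ℝ g).subtype

/-- `x` is a unit normal vector of the ideal `h` for the metric in which `e` is orthonormal. -/
def IsUnitNormal (e : Module.Basis (Fin 7) ℝ g) (h : LieIdeal ℝ g) (x : g) : Prop :=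
  frameInner e x x = 1 ∧ ∀ y ∈ h, frameInner e x y = 0

/-- The 2-form `ω = x ⌟ φ` on `h`. -/
def inducedOmega (φ : g [⋀^Fin 3]→ₗ[ℝ] ℝ) (h : LieIdeal ℝ g) (x : g) : h [⋀^Fin 2]→ₗ[ℝ] ℝ :=
  restrictForm h (contraction x φ)

/-- The 3-form `ψ = -x ⌟ ϕ` on `h`. -/
def inducedPsi (ϕ : g [⋀^Fin 4]→ₗ[ℝ] ℝ) (h : LieIdeal ℝ g) (x : g) : h [⋀^Fin 3]→ₗ[ℝ] ℝ :=
  -restrictForm h (contraction x ϕ)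

/-- `A` belongs to the Lie algebra `su(h) ≅ su(3)` of the `SU(3)`-structure `(ω, ψ)` induced on `h`
by the `G₂`-structure and the unit normal `x`: it is skew-symmetric for the induced metric and
infinitesimally preserves `ω` and `ψ`. (So `A` commutes with the induced complex structure and
its complex trace vanishes. Skew-symmetry follows from the other two conditions; it is
listed for definiteness.) -/
structure MemSU (e : Module.Basis (Fin 7) ℝ g) (φ : g [⋀^Fin 3]→ₗ[ℝ] ℝ) (h : LieIdeal ℝ g) (x : g)
    (A : Module.End ℝ h) : Prop where
  skew : ∀ u v : h, frameInner e (A u : g) (v : g) = -frameInner e (u : g) (A v : g)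
  omega : formAction A (inducedOmega φ h x) = 0
  psi : formAction A (inducedPsi (hodgeStar e (m := 4) rfl φ) h x) = 0

end SU3

end

end G2Coflow

/-!
Write `φ = ω ∧ x♭ + ρ` with respect to the unit normal `x` of the abelian ideal `h`, so that
`⋆φ = ω ∧ ω / 2 + ψ ∧ x♭`, where `Ω = ρ + iψ` is the complex volume form of the induced
`SU(3)`-structure, and let `A = ad x` on `h`. On `h` one has `(dα)|_h = 0` and
`x ⌟ dα = ϑ(A)(α|_h)` (`extD_apply_of_mem`, `extD_apply_cons`).

Since `⋆φ` is closed, `Δ⋆φ = d⋆dφ` is exact and therefore vanishes on `h`, whereas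
`(⋆φ)|_h = ω ∧ ω / 2` does not; so the eigenvalue is zero, and `Δ⋆φ = 0`. The equations
`d⋆φ = 0` and `Δ⋆φ = 0` then place `A` in the stabiliser algebra:

* `d⋆φ = 0` says `ω ∧ ϑ(A)ω = 0`, hence `ϑ(A)ω = 0` by the Lefschetz property
  (`formAction_eq_zero_of_halfSquare`); in particular `A` is trace-free.
* For trace-free `A` the form `β = (⋆dφ)|_h` is `⋆ϑ(A)ρ = -ϑ(Aᵀ)ψ` (`star_formAction_re`), and
  `d⋆dφ = 0` says `ϑ(A)β = 0`. Pairing with `ψ` gives `|ϑ(Aᵀ)ψ|² = 0`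
  (`formAction_transpose_eq_zero`).
* `ϑ(A)ω = 0` and `ϑ(Aᵀ)ψ = 0` force `Aᵀ = -A` (`skew_of_symplectic`), so also `ϑ(A)ψ = 0`.

All this is computed in an adapted frame whose last vector is `x`. Its existence
(`exists_adaptedFrame_last`) is the transitivity of `G₂` on the unit sphere: the frame is generated
by `x` and two further vectors under the cross product of `φ`. Passing from one orthonormal frame
to another changes the Hodge star at most by a sign (`hodgeStar_orthonormal`), which does not affect
any of the conditions.
-/

namespace G2Coflow

/-! ### Forms and the Hodge star on a basis -/

section Forms

variable {V : Type*} [AddCommGroup V] [Module ℝ V]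

/-- Two alternating forms agree if they agree on the increasing families of basis vectors. -/
theorem ext_alternating_strictMono {n k : ℕ} (b : Module.Basis (Fin n) ℝ V)
    {α β : V [⋀^Fin k]→ₗ[ℝ] ℝ}
    (h : ∀ v : Fin k → Fin n, StrictMono v → α (b ∘ v) = β (b ∘ v)) : α = β := by
  refine Module.Basis.ext_alternating b fun v hv => ?_
  have hs : StrictMono (v ∘ Tuple.sort v) :=
    (Tuple.monotone_sort v).strictMono_of_injective (hv.comp (Tuple.sort v).injective)
  have h1 := h _ hs
  have key : ∀ γ : V [⋀^Fin k]→ₗ[ℝ] ℝ, γ (b ∘ (v ∘ Tuple.sort v))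
      = Equiv.Perm.sign (Tuple.sort v) • γ (fun i => b (v i)) := fun γ =>
    γ.map_perm (fun i => b (v i)) (Tuple.sort v)
  rw [key, key] at h1
  exact smul_left_cancel _ h1

theorem sum_form_apply {ι : Type*} {k : ℕ} (s : Finset ι) (α : ι → V [⋀^Fin k]→ₗ[ℝ] ℝ)
    (v : Fin k → V) : (∑ i ∈ s, α i) v = ∑ i ∈ s, α i v := by
  classical
  induction s using Finset.induction_on with
  | empty => simp
  | insert i s hi ih =>
    rw [Finset.sum_insert hi, Finset.sum_insert hi, AlternatingMap.add_apply, ih]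

theorem insertVectors_apply {k m n : ℕ} (h : k + m = n) (β : V [⋀^Fin n]→ₗ[ℝ] ℝ) (a : Fin k → V)
    (w : Fin m → V) : insertVectors h β a w = β (Fin.append a w ∘ Fin.cast h.symm) :=
  rfl

theorem basis_det_perm (e : Module.Basis (Fin 7) ℝ V) (σ : Equiv.Perm (Fin 7)) :
    e.det (e ∘ σ) = ((Equiv.Perm.sign σ : ℤ) : ℝ) := by
  rw [AlternatingMap.map_perm, e.det_self, Units.smul_def]
  simp

/-- On basis vectors, the Hodge star is, up to the sign of the permutation, the passage to the
complementary indices. -/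
theorem hodgeStar_apply_perm (e : Module.Basis (Fin 7) ℝ V) {k m : ℕ} (h : k + m = 7)
    (α : V [⋀^Fin k]→ₗ[ℝ] ℝ) (σ : Equiv.Perm (Fin 7)) :
    hodgeStar e h α (e ∘ σ ∘ Fin.cast h ∘ Fin.natAdd k)
      = ((Equiv.Perm.sign σ : ℤ) : ℝ) * α (e ∘ σ ∘ Fin.cast h ∘ Fin.castAdd m) := by
  set I : Fin k → Fin 7 := σ ∘ Fin.cast h ∘ Fin.castAdd m with hI
  set J : Fin m → Fin 7 := σ ∘ Fin.cast h ∘ Fin.natAdd k with hJ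
  have hIinj : Function.Injective I :=
    σ.injective.comp ((Fin.cast_injective h).comp (Fin.castAdd_injective k m))
  -- Only the families `i = I ∘ τ`, `τ` a permutation, contribute, all of them equally.
  have hsum : ∑ i : Fin k → Fin 7, α (e ∘ i) * insertVectors h e.det (e ∘ i) (e ∘ J)
      = ∑ _τ : Equiv.Perm (Fin k), ((Equiv.Perm.sign σ : ℤ) : ℝ) * α (e ∘ I) := by
    symm
    refine Fintype.sum_of_injective (fun τ : Equiv.Perm (Fin k) => I ∘ τ) ?_ _ _ ?_ ?_
    · intro τ τ' hτ
      ext a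
      exact congrArg Fin.val (hIinj (congrFun hτ a))
    · intro i hi
      by_cases hinj : Function.Injective (Fin.append i J ∘ Fin.cast h.symm)
      · exfalso
        apply hi
        have hap : Function.Injective (Fin.append i J) := by
          have := hinj.comp (Fin.cast_injective h)
          simpa [Function.comp_def] using this
        have hex : ∀ a, ∃ b, I b = i a := by
          intro a
          obtain ⟨y, hy⟩ := (σ.surjective.comp
            (finCongr h).surjective) (i a)
          induction y using Fin.addCases with
          | left b => exact ⟨b, hy⟩
          | right b =>
            have h1 : Fin.append i J (Fin.castAdd m a) = Fin.append i J (Fin.natAdd k b) := by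
              rw [Fin.append_left, Fin.append_right]
              exact hy.symm
            have h2 := hap h1
            simp only [Fin.ext_iff, Fin.val_castAdd, Fin.val_natAdd] at h2
            omega
        choose t ht using hex
        have htinj : Function.Injective t := by
          intro a b hab
          have h1 : i a = i b := by rw [← ht a, ← ht b, hab]
          have h2 : Fin.append i J (Fin.castAdd m a) = Fin.append i J (Fin.castAdd m b) := by
            simpa using h1
          simpa using hap h2
        exact ⟨Equiv.ofBijective t (Finite.injective_iff_bijective.mp htinj), funext ht⟩
      · have h0 : insertVectors h e.det (e ∘ i) (e ∘ J) = 0 := by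
          refine e.det.map_eq_zero_of_not_injective _ fun hc => hinj ?_
          have h1 : Fin.append (e ∘ i) (e ∘ J) ∘ Fin.cast h.symm
              = e ∘ (Fin.append i J ∘ Fin.cast h.symm) := by
            funext l
            simp only [Function.comp_apply]
            refine Fin.addCases (fun l => ?_) (fun l => ?_) (Fin.cast h.symm l) <;> simp
          rw [h1] at hc
          exact hc.of_comp
        rw [h0, mul_zero]
    · intro τ
      set ε := finSumFinEquiv.trans (finCongr h)
      have h1 : Fin.append (e ∘ I ∘ τ) (e ∘ J) ∘ Fin.cast h.symm
          = e ∘ (σ * ε.permCongr (Equiv.Perm.sumCongr τ 1)) := by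
        funext l
        obtain ⟨l, rfl⟩ := ε.surjective l
        have hl : Fin.cast h.symm (ε l) = finSumFinEquiv l := rfl
        have hr : (σ * ε.permCongr (Equiv.Perm.sumCongr τ 1)) (ε l)
            = σ (ε (Equiv.Perm.sumCongr τ 1 l)) := by
          rw [Equiv.Perm.mul_apply, Equiv.permCongr_apply, Equiv.symm_apply_apply]
        change Fin.append (e ∘ I ∘ τ) (e ∘ J) (Fin.cast h.symm (ε l))
          = e ((σ * ε.permCongr (Equiv.Perm.sumCongr τ 1)) (ε l))
        refine (congrArg _ hl).trans (Eq.trans ?_ (congrArg e hr).symm)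
        rcases l with l | l
        · rw [finSumFinEquiv_apply_left, Fin.append_left]
          rfl
        · rw [finSumFinEquiv_apply_right, Fin.append_right]
          rfl
      have h2 : insertVectors h e.det (e ∘ I ∘ τ) (e ∘ J)
          = ((Equiv.Perm.sign σ : ℤ) : ℝ) * ((Equiv.Perm.sign τ : ℤ) : ℝ) := by
        rw [insertVectors_apply, h1, basis_det_perm]
        simp
      have h3 : α (e ∘ I ∘ τ) = ((Equiv.Perm.sign τ : ℤ) : ℝ) * α (e ∘ I) := by
        have := α.map_perm (e ∘ I) τ
        rw [Units.smul_def, zsmul_eq_mul] at this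
        exact this
      rw [h2, h3]
      have h4 : ((Equiv.Perm.sign τ : ℤ) : ℝ) * ((Equiv.Perm.sign τ : ℤ) : ℝ) = 1 := by
        rcases Int.units_eq_one_or (Equiv.Perm.sign τ) with h | h <;> simp [h]
      linear_combination (-((Equiv.Perm.sign σ : ℤ) : ℝ) * α (e ∘ I)) * h4
  have hk : (k.factorial : ℝ) ≠ 0 := by exact_mod_cast k.factorial_ne_zero
  have : hodgeStar e h α (e ∘ J) = (1 / (k.factorial : ℝ)) *
      ∑ i : Fin k → Fin 7, α (e ∘ i) * insertVectors h e.det (e ∘ i) (e ∘ J) := by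
    rw [hodgeStar, AlternatingMap.smul_apply, smul_eq_mul]
    congr 1
    rw [sum_form_apply]
    rfl
  rw [this, hsum]
  simp only [Finset.sum_const, Finset.card_univ, Fintype.card_perm, Fintype.card_fin, nsmul_eq_mul]
  field_simp

/-- The sign of a sequence of seven distinct indices, in a form that evaluates by computation.
It has no meaning when two of the indices coincide. -/
def indexSign (K : Fin 7 → Fin 7) : ℤ :=
  ∏ j, ∏ i ∈ Finset.Iio j, if K i < K j then 1 else -1

theorem sign_eq_indexSign (σ : Equiv.Perm (Fin 7)) :
    (Equiv.Perm.sign σ : ℤ) = indexSign σ := by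
  rw [Equiv.Perm.sign_eq_prod_prod_Iio, indexSign]
  push_cast
  refine Finset.prod_congr rfl fun i _ => Finset.prod_congr rfl fun j _ => ?_
  split_ifs <;> simp

theorem hodgeStar_three_apply (e : Module.Basis (Fin 7) ℝ V) (α : V [⋀^Fin 3]→ₗ[ℝ] ℝ)
    (a b c i j k l : Fin 7) (hK : Function.Injective ![a, b, c, i, j, k, l]) :
    hodgeStar e (m := 4) rfl α ![e i, e j, e k, e l]
      = (indexSign ![a, b, c, i, j, k, l] : ℝ) * α ![e a, e b, e c] := by
  set σ := Equiv.ofBijective _ (Finite.injective_iff_bijective.mp hK)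
  have h := hodgeStar_apply_perm e (m := 4) rfl α σ
  rw [sign_eq_indexSign] at h
  convert h using 2
  · funext t; fin_cases t <;> rfl
  · rfl
  · congr 1
    funext t; fin_cases t <;> rfl

theorem hodgeStar_four_apply (e : Module.Basis (Fin 7) ℝ V) (α : V [⋀^Fin 4]→ₗ[ℝ] ℝ)
    (a b c d i j k : Fin 7) (hK : Function.Injective ![a, b, c, d, i, j, k]) :
    hodgeStar e (m := 3) rfl α ![e i, e j, e k]
      = (indexSign ![a, b, c, d, i, j, k] : ℝ) * α ![e a, e b, e c, e d] := by
  set σ := Equiv.ofBijective _ (Finite.injective_iff_bijective.mp hK)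
  have h := hodgeStar_apply_perm e (m := 3) rfl α σ
  rw [sign_eq_indexSign] at h
  convert h using 2
  · funext t; fin_cases t <;> rfl
  · rfl
  · congr 1
    funext t; fin_cases t <;> rfl

/-- In dimension seven the Hodge star is an involution: the cyclic shift which exchanges the two
blocks of indices is even. -/
theorem hodgeStar_hodgeStar_three (e : Module.Basis (Fin 7) ℝ V) (α : V [⋀^Fin 3]→ₗ[ℝ] ℝ) :
    hodgeStar e (m := 3) rfl (hodgeStar e (m := 4) rfl α) = α := by
  refine ext_alternating_strictMono e fun v hv => ?_
  obtain ⟨σ, hσ⟩ := Equiv.Perm.exists_extending_pair (Fin.natAdd 4 : Fin 3 → Fin 7) v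
    (Fin.natAdd_injective 3 4) hv.injective
  have h1 := hodgeStar_apply_perm e (k := 4) (m := 3) rfl (hodgeStar e (m := 4) rfl α) σ
  have h2 := hodgeStar_apply_perm e (k := 3) (m := 4) rfl α (σ * Equiv.addRight (4 : Fin 7))
  have hs : Equiv.Perm.sign (Equiv.addRight (4 : Fin 7)) = 1 := by decide
  have e1 : e ∘ σ ∘ Fin.cast (rfl : 4 + 3 = 7) ∘ Fin.natAdd 4 = e ∘ v :=
    funext fun t => congrArg e (hσ t)
  have e2 : e ∘ (σ * Equiv.addRight (4 : Fin 7)) ∘ Fin.cast (rfl : 3 + 4 = 7) ∘ Fin.natAdd 3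
      = e ∘ σ ∘ Fin.cast (rfl : 4 + 3 = 7) ∘ Fin.castAdd 3 := by
    funext t; fin_cases t <;> rfl
  have e3 : e ∘ (σ * Equiv.addRight (4 : Fin 7)) ∘ Fin.cast (rfl : 3 + 4 = 7) ∘ Fin.castAdd 4
      = e ∘ v := by
    rw [← e1]
    funext t; fin_cases t <;> rfl
  rw [Equiv.Perm.sign_mul, hs, mul_one] at h2
  generalize hodgeStar e (m := 3) rfl (hodgeStar e (m := 4) rfl α) = γ at h1 ⊢
  generalize hodgeStar e (m := 4) rfl α = β at h1 h2
  replace h2 := ((congrArg β e2).symm.trans h2).trans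
    (congrArg (fun w => ((Equiv.Perm.sign σ : ℤ) : ℝ) * α w) e3)
  replace h1 := (congrArg γ e1).symm.trans
    (h1.trans (congrArg (fun r => ((Equiv.Perm.sign σ : ℤ) : ℝ) * r) h2))
  rw [h1, ← mul_assoc]
  rcases Int.units_eq_one_or (Equiv.Perm.sign σ) with h | h <;> rw [h] <;> norm_num

end Forms

/-! ### The cross product of the model form -/

section CrossProduct

/-- The cross product `a × b` on `R⁷` defined by the model 3-form `φ₀`, that is, by
`⟨a × b, c⟩ = φ₀(a, b, c)`. The ring is arbitrary so that the structure constants, the case of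
integer standard vectors, can be computed. -/
def cross {R : Type*} [CommRing R] (a b : Fin 7 → R) : Fin 7 → R :=
  ![a 1 * b 6 - a 6 * b 1 + (a 2 * b 4 - a 4 * b 2) - (a 3 * b 5 - a 5 * b 3),
    a 6 * b 0 - a 0 * b 6 - (a 2 * b 5 - a 5 * b 2) - (a 3 * b 4 - a 4 * b 3),
    a 3 * b 6 - a 6 * b 3 + (a 4 * b 0 - a 0 * b 4) - (a 5 * b 1 - a 1 * b 5),
    a 6 * b 2 - a 2 * b 6 - (a 5 * b 0 - a 0 * b 5) - (a 4 * b 1 - a 1 * b 4),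
    a 5 * b 6 - a 6 * b 5 + (a 0 * b 2 - a 2 * b 0) - (a 1 * b 3 - a 3 * b 1),
    a 6 * b 4 - a 4 * b 6 - (a 0 * b 3 - a 3 * b 0) - (a 1 * b 2 - a 2 * b 1),
    a 0 * b 1 - a 1 * b 0 + (a 2 * b 3 - a 3 * b 2) + (a 4 * b 5 - a 5 * b 4)]

/-- The structure constants `φ₀(eᵢ, eⱼ, e_k)` of the model form. -/
def modelCoeff (i j k : Fin 7) : ℤ :=
  cross (Pi.single i (1 : ℤ)) (Pi.single j 1) k

theorem cross_swap (a b : Fin 7 → ℝ) : cross b a = -cross a b := by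
  funext i
  fin_cases i <;> simp [cross] <;> ring

theorem cross_neg (a b : Fin 7 → ℝ) : cross a (-b) = -cross a b := by
  funext i
  fin_cases i <;> simp [cross] <;> ring

/-- The polarisation of `a × (a × c) = ⟨a, c⟩ a - |a|² c`. -/
theorem cross_cross_add (a b c : Fin 7 → ℝ) :
    cross a (cross b c) = -cross b (cross a c)
      + ((dotProduct a c) • b + (dotProduct b c) • a - (2 * dotProduct a b) • c) := by
  funext i
  fin_cases i <;> simp [cross, dotProduct, Fin.sum_univ_seven] <;> ring

theorem cross_cross_self (a c : Fin 7 → ℝ) :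
    cross a (cross a c) = (dotProduct a c) • a - (dotProduct a a) • c := by
  funext i
  fin_cases i <;> simp [cross, dotProduct, Fin.sum_univ_seven] <;> ring

theorem dotProduct_cross (a b c : Fin 7 → ℝ) :
    dotProduct (cross a b) c = dotProduct a (cross b c) := by
  simp [cross, dotProduct, Fin.sum_univ_seven]
  ring

theorem cross_self (a : Fin 7 → ℝ) : cross a a = 0 := by
  funext i
  fin_cases i <;> simp [cross] <;> ring

theorem dotProduct_cross_cross (a b c : Fin 7 → ℝ) :
    dotProduct (cross a b) (cross a c)
      = dotProduct a a * dotProduct b c - dotProduct a b * dotProduct a c := by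
  rw [cross_swap b a, neg_dotProduct, dotProduct_cross, cross_cross_self]
  simp only [dotProduct_sub, dotProduct_smul, smul_eq_mul, dotProduct_comm b a]
  ring

theorem exists_unit_orthogonal (p q r : Fin 7 → ℝ) :
    ∃ u : Fin 7 → ℝ, dotProduct u u = 1 ∧ dotProduct p u = 0 ∧ dotProduct q u = 0
      ∧ dotProduct r u = 0 := by
  have hlt : Module.finrank ℝ (Fin 3 → ℝ) < Module.finrank ℝ (Fin 7 → ℝ) := by simp
  obtain ⟨w, hw, hw0⟩ := (Submodule.ne_bot_iff _).mp
    (LinearMap.ker_ne_bot_of_finrank_lt (f := Matrix.mulVecLin (Matrix.of ![p, q, r])) hlt)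
  rw [LinearMap.mem_ker, Matrix.mulVecLin_apply] at hw
  have hp : dotProduct p w = 0 := congrFun hw 0
  have hq : dotProduct q w = 0 := congrFun hw 1
  have hr : dotProduct r w = 0 := congrFun hw 2
  have hpos : 0 < dotProduct w w := by
    refine lt_of_le_of_ne (Finset.sum_nonneg fun i _ => mul_self_nonneg _) fun h0 => hw0 ?_
    exact dotProduct_self_eq_zero.mp h0.symm
  refine ⟨(Real.sqrt (dotProduct w w))⁻¹ • w, ?_, ?_, ?_, ?_⟩
  · rw [smul_dotProduct, dotProduct_smul, smul_eq_mul, smul_eq_mul, ← mul_assoc, ← mul_inv,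
      Real.mul_self_sqrt hpos.le, inv_mul_cancel₀ hpos.ne']
  all_goals simp [dotProduct_smul, hp, hq, hr]

/-- The frame generated by two orthonormal vectors `x`, `u` and a unit vector `v` orthogonal to
`x`, `u` and `x × u`; its last vector is `x`. -/
def generatedFrame (x u v : Fin 7 → ℝ) : Fin 7 → Fin 7 → ℝ :=
  ![u, cross x u, v, cross x v, cross u v, cross x (cross u v), x]

variable {x u v : Fin 7 → ℝ}

theorem generatedFrame_orthonormal (hxx : dotProduct x x = 1) (huu : dotProduct u u = 1)
    (hvv : dotProduct v v = 1) (hxu : dotProduct x u = 0) (hxv : dotProduct x v = 0)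
    (huv : dotProduct u v = 0) (hxuv : dotProduct (cross x u) v = 0) (i j : Fin 7) :
    dotProduct (generatedFrame x u v i) (generatedFrame x u v j) = if i = j then 1 else 0 := by
  have hux : dotProduct u x = 0 := by rw [dotProduct_comm, hxu]
  have hvx : dotProduct v x = 0 := by rw [dotProduct_comm, hxv]
  have hvu : dotProduct v u = 0 := by rw [dotProduct_comm, huv]
  have hx_uv : dotProduct x (cross u v) = 0 := by rw [← dotProduct_cross, hxuv]
  have hxy : dotProduct x (cross u v) = 0 := by rw [← dotProduct_cross, hxuv]
  have perp : ∀ a b : Fin 7 → ℝ, dotProduct a (cross a b) = 0 := fun a b => by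
    rw [← dotProduct_cross, cross_self, zero_dotProduct]
  have swap : ∀ a b c : Fin 7 → ℝ, dotProduct a (cross b c) = -dotProduct b (cross a c) :=
    fun a b c => by rw [← dotProduct_cross, cross_swap b a, neg_dotProduct, dotProduct_cross]
  have hvy : dotProduct v (cross u v) = 0 := by rw [swap, cross_self]; simp
  have hyy : dotProduct (cross u v) (cross u v) = 1 := by
    rw [dotProduct_cross_cross, huu, hvv, huv]; norm_num
  have hu_xv : dotProduct u (cross x v) = 0 := by rw [swap, hxy, neg_zero]
  have hu_xy : dotProduct u (cross x (cross u v)) = 0 := by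
    rw [swap, cross_cross_self, huv, huu]; simp [hxv]
  have hv_xy : dotProduct v (cross x (cross u v)) = 0 := by
    rw [swap, cross_swap v u, cross_neg, cross_cross_self, hvu, hvv]; simp [hxu]
  have hxu_y : dotProduct (cross x u) (cross u v) = 0 := by
    rw [dotProduct_cross, cross_cross_self, huv, huu]; simp [hxv]
  have hxv_y : dotProduct (cross x v) (cross u v) = 0 := by
    rw [dotProduct_cross, cross_swap v u, cross_neg, cross_cross_self, hvu, hvv]; simp [hxu]
  have hxx' : ∀ a b : Fin 7 → ℝ, dotProduct x a = 0 →
      dotProduct (cross x a) (cross x b) = dotProduct a b := fun a b h => by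
    rw [dotProduct_cross_cross, hxx, h]; ring
  have hcx : ∀ a : Fin 7 → ℝ, dotProduct (cross x a) x = 0 := fun a => by
    rw [dotProduct_comm, perp]
  have hpos : ∀ a, dotProduct a (cross x a) = 0 := fun a => by rw [swap, cross_self]; simp
  have hyx : dotProduct (cross u v) x = 0 := by rw [dotProduct_comm, hxy]
  have hdiag : ∀ i, dotProduct (generatedFrame x u v i) (generatedFrame x u v i) = 1 := by
    intro i
    fin_cases i
    · exact huu
    · exact (hxx' u u hxu).trans huu
    · exact hvv
    · exact (hxx' v v hxv).trans hvv
    · exact hyy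
    · exact (hxx' _ _ hxy).trans hyy
    · exact hxx
  have hoff : ∀ i j, i < j →
      dotProduct (generatedFrame x u v i) (generatedFrame x u v j) = 0 := by
    intro i j hij
    fin_cases i <;> fin_cases j <;> first
      | exact absurd hij (by decide)
      | simp [generatedFrame, hux, hvx, huv, hu_xv, hu_xy, hv_xy, hxu_y, hxv_y, hcx, hpos,
          hxx', hxu, hxv, hxuv, hvy, perp, hyx]
  rcases lt_trichotomy i j with h | h | h
  · rw [hoff i j h, if_neg h.ne]
  · rw [h, hdiag, if_pos rfl]
  · rw [dotProduct_comm, hoff j i h, if_neg h.ne']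

/-- The generated frame has the multiplication table of the standard one. -/
theorem cross_generatedFrame (hxx : dotProduct x x = 1) (huu : dotProduct u u = 1)
    (hvv : dotProduct v v = 1) (hxu : dotProduct x u = 0) (hxv : dotProduct x v = 0)
    (huv : dotProduct u v = 0) (hxuv : dotProduct (cross x u) v = 0) (i j : Fin 7) (hij : i < j) :
    cross (generatedFrame x u v i) (generatedFrame x u v j)
      = ∑ k, (modelCoeff i j k : ℝ) • generatedFrame x u v k := by
  have orth := generatedFrame_orthonormal hxx huu hvv hxu hxv huv hxuv
  have hyy : dotProduct (cross u v) (cross u v) = 1 := orth 4 4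
  -- Products of three mutually orthogonal vectors associate up to sign.
  have anti : ∀ a b c : Fin 7 → ℝ, dotProduct a c = 0 → dotProduct b c = 0 → dotProduct a b = 0 →
      cross a (cross b c) = -cross b (cross a c) := fun a b c h1 h2 h3 => by
    rw [cross_cross_add, h1, h2, h3]; simp
  have sq : ∀ a c : Fin 7 → ℝ, dotProduct a a = 1 → dotProduct a c = 0 →
      cross a (cross a c) = -c := fun a c h1 h2 => by
    rw [cross_cross_self, h1, h2]; simp
  have sq' : ∀ a c : Fin 7 → ℝ, dotProduct a a = 1 → dotProduct a c = 0 →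
      cross a (cross c a) = c := fun a c h1 h2 => by
    rw [cross_swap a c, cross_neg, sq a c h1 h2, neg_neg]
  have hux := (dotProduct_comm u x).trans hxu
  have hvx := (dotProduct_comm v x).trans hxv
  have hvu := (dotProduct_comm v u).trans huv
  have hxy : dotProduct x (cross u v) = 0 := orth 6 4
  have huy : dotProduct u (cross u v) = 0 := orth 0 4
  have hvy : dotProduct v (cross u v) = 0 := orth 2 4
  -- `pij` is the product of the frame vectors `i` and `j`.
  have p03 : cross u (cross x v) = -cross x (cross u v) := anti _ _ _ huv hxv hux
  have p21 : cross v (cross x u) = cross x (cross u v) := by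
    rw [anti _ _ _ hvu hxu hvx, cross_swap u v, cross_neg, neg_neg]
  have p12 : cross (cross x u) v = -cross x (cross u v) := by rw [cross_swap v, p21]
  have p30 : cross (cross x v) u = cross x (cross u v) := by rw [cross_swap u, p03, neg_neg]
  have p05 : cross u (cross x (cross u v)) = cross x v := by
    rw [anti _ _ _ huy hxy hux, sq _ _ huu huv, cross_neg, neg_neg]
  have p25 : cross v (cross x (cross u v)) = -cross x u := by
    rw [anti _ _ _ hvy hxy hvx, sq' _ _ hvv hvu]
  have p13 : cross (cross x u) (cross x v) = -cross u v := by
    rw [anti _ _ _ hxuv hxv (orth 1 6), p12, cross_neg, sq _ _ hxx hxy]; simp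
  have p14 : cross (cross x u) (cross u v) = cross x v := by
    rw [anti _ _ _ hxuv huv (orth 1 0), p12, cross_neg, p05]; simp
  have p34 : cross (cross x v) (cross u v) = -cross x u := by
    rw [cross_swap v u, cross_neg, anti (cross x v) v u (orth 3 0) hvu (orth 3 2), p30, p25]; simp
  have p15 : cross (cross x u) (cross x (cross u v)) = v := by
    rw [anti (cross x u) x (cross u v) (orth 1 4) hxy (orth 1 6), p14, sq _ _ hxx hxv, neg_neg]
  have p35 : cross (cross x v) (cross x (cross u v)) = -u := by
    rw [anti (cross x v) x (cross u v) (orth 3 4) hxy (orth 3 6), p34, cross_neg, sq _ _ hxx hxu]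
    simp
  have hcx : ∀ c, dotProduct x c = 0 → cross (cross x c) x = c := fun c h => by
    rw [cross_swap x, sq _ _ hxx h, neg_neg]
  have p01 : cross u (cross x u) = x := sq' _ _ huu hux
  have p23 : cross v (cross x v) = x := sq' _ _ hvv hvx
  have p45 : cross (cross u v) (cross x (cross u v)) = x :=
    sq' _ _ hyy ((dotProduct_comm _ _).trans hxy)
  have p04 : cross u (cross u v) = -v := sq _ _ huu huv
  have p24 : cross v (cross u v) = u := sq' _ _ hvv hvu
  have p06 : cross u x = -cross x u := cross_swap _ _
  have p26 : cross v x = -cross x v := cross_swap _ _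
  have p46 : cross (cross u v) x = -cross x (cross u v) := cross_swap _ _
  fin_cases i <;> fin_cases j <;> first
    | exact absurd hij (by decide)
    | simp [generatedFrame, Fin.sum_univ_seven, modelCoeff, cross.eq_1 (R := ℤ), p01, p03, p04,
        p05, p06, p12, p13, p14, p15, p23, p24, p25, p26, p34, p35, p45, p46, hcx, hxu, hxv, hxy]

end CrossProduct

/-! ### Adapted frames with a prescribed last vector -/

section Frames

variable {V : Type*} [AddCommGroup V] [Module ℝ V]

theorem modelForm_apply (e : Module.Basis (Fin 7) ℝ V) (x y z : V) :
    modelForm e ![x, y, z] = dotProduct (cross (e.equivFun x) (e.equivFun y)) (e.equivFun z) := by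
  have h3 : ∀ i j k, coframe3 e i j k ![x, y, z]
      = Matrix.det (Matrix.of fun r c => e.coord (![i, j, k] c) (![x, y, z] r)) := fun _ _ _ => rfl
  simp only [modelForm, AlternatingMap.sub_apply, AlternatingMap.add_apply, h3,
    Matrix.det_fin_three]
  simp [dotProduct, Fin.sum_univ_seven, cross]
  ring

theorem modelForm_basis (e : Module.Basis (Fin 7) ℝ V) (i j k : Fin 7) :
    modelForm e ![e i, e j, e k] = modelCoeff i j k := by
  have hs : ∀ i, e.equivFun (e i) = fun t => ((Pi.single i (1 : ℤ) : Fin 7 → ℤ) t : ℝ) := by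
    intro i
    funext t
    simp [Pi.single_apply, eq_comm]
  have hc : ∀ a b : Fin 7 → ℤ, cross (fun t => (a t : ℝ)) (fun t => (b t : ℝ))
      = fun t => ((cross a b t : ℤ) : ℝ) := by
    intro a b
    funext t
    fin_cases t <;> simp [cross]
  rw [modelForm_apply, hs, hs, hc]
  simp [modelCoeff, dotProduct]

theorem frameInner_eq_dotProduct (e : Module.Basis (Fin 7) ℝ V) (x y : V) :
    frameInner e x y = dotProduct (e.equivFun x) (e.equivFun y) :=
  rfl

/-- `G₂` acts transitively on the unit sphere: every unit vector is the last vector of an adapted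
orthonormal frame. (Its orientation is automatically the given one, but orthonormality suffices
below.) -/
theorem exists_adaptedFrame_last (e : Module.Basis (Fin 7) ℝ V) (x : V)
    (hx : frameInner e x x = 1) :
    ∃ f : Module.Basis (Fin 7) ℝ V, modelForm f = modelForm e ∧ f 6 = x ∧
      ∀ i j, frameInner e (f i) (f j) = if i = j then 1 else 0 := by
  set a := e.equivFun x with ha
  have haa : dotProduct a a = 1 := hx
  obtain ⟨b, hbb, hab, -, -⟩ := exists_unit_orthogonal a 0 0
  obtain ⟨c, hcc, hac, hbc, habc⟩ := exists_unit_orthogonal a b (cross a b)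
  have horth := generatedFrame_orthonormal haa hbb hcc hab hac hbc habc
  have hcross := cross_generatedFrame haa hbb hcc hab hac hbc habc
  set F := generatedFrame a b c
  have hF6 : F 6 = a := rfl
  clear_value F
  have hli : LinearIndependent ℝ F := by
    rw [Fintype.linearIndependent_iff]
    intro t ht i
    have := congrArg (fun w => dotProduct w (F i)) ht
    simpa [sum_dotProduct, smul_dotProduct, horth] using this
  let f := (basisOfLinearIndependentOfCardEqFinrank hli (by simp)).map e.equivFun.symm
  have hf : ∀ i, e.equivFun (f i) = F i := fun i => by
    rw [Module.Basis.map_apply, LinearEquiv.apply_symm_apply,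
      coe_basisOfLinearIndependentOfCardEqFinrank]
  refine ⟨f, ?_, ?_, fun i j => ?_⟩
  · refine ext_alternating_strictMono f fun v hv => ?_
    have hv3 : f ∘ v = ![f (v 0), f (v 1), f (v 2)] := by
      funext t; fin_cases t <;> rfl
    rw [hv3, modelForm_basis, modelForm_apply, hf, hf, hf, hcross _ _ (hv (by decide))]
    simp [sum_dotProduct, smul_dotProduct, horth]
  · exact e.equivFun.injective (by rw [hf, hF6])
  · rw [frameInner_eq_dotProduct, hf, hf, horth]

variable {e f : Module.Basis (Fin 7) ℝ V}

theorem frameInner_expand (e : Module.Basis (Fin 7) ℝ V) (c : Fin 7 → ℝ) (v : Fin 7 → V) (y : V) :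
    frameInner e (∑ i, c i • v i) y = ∑ i, c i * frameInner e (v i) y := by
  simp [frameInner_eq_dotProduct, map_sum, sum_dotProduct, smul_dotProduct]

theorem frameInner_comm (e : Module.Basis (Fin 7) ℝ V) (x y : V) :
    frameInner e x y = frameInner e y x :=
  dotProduct_comm _ _

/-- An orthonormal basis defines the same inner product. -/
theorem frameInner_eq (hf : ∀ i j, frameInner e (f i) (f j) = if i = j then 1 else 0) (x y : V) :
    frameInner f x y = frameInner e x y := by
  conv_rhs => rw [← f.sum_repr x, frameInner_expand]
  refine Finset.sum_congr rfl fun i _ => ?_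
  rw [Module.Basis.coord_apply, Module.Basis.coord_apply, frameInner_comm e]
  conv_rhs => rw [← f.sum_repr y, frameInner_expand]
  simp [hf]

/-- `∑ B(eᵢ) C(eᵢ)` over all index families does not depend on the orthonormal basis. -/
theorem sum_multilinear_orthonormal {k : ℕ}
    (hf : ∀ i j, frameInner e (f i) (f j) = if i = j then 1 else 0)
    (B C : MultilinearMap ℝ (fun _ : Fin k => V) ℝ) :
    ∑ i : Fin k → Fin 7, B (e ∘ i) * C (e ∘ i) = ∑ i : Fin k → Fin 7, B (f ∘ i) * C (f ∘ i) := by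
  -- The transition matrix `Q` from `f` to `e`, with `Q Qᵀ = 1`.
  set Q : Fin 7 → Fin 7 → ℝ := fun i j => f.repr (e i) j with hQ
  have hexp : ∀ i, e i = ∑ j, Q i j • f j := fun i => (f.sum_repr (e i)).symm
  have hcol : ∀ j j', ∑ i, Q i j * Q i j' = if j = j' then 1 else 0 := by
    have hQe : ∀ i j, Q i j = e.repr (f j) i := by
      intro i j
      have h1 : frameInner f (e i) (f j) = Q i j := by
        simp [frameInner, hQ, Finsupp.single_apply]
      have h2 : frameInner e (e i) (f j) = e.repr (f j) i := by
        simp [frameInner, Finsupp.single_apply]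
      rw [← h1, frameInner_eq hf, h2]
    intro j j'
    rw [← hf j j']
    exact Finset.sum_congr rfl fun i _ => by rw [hQe, hQe]; rfl
  have hmul : ∀ (D : MultilinearMap ℝ (fun _ : Fin k => V) ℝ) (i : Fin k → Fin 7),
      D (e ∘ i) = ∑ j : Fin k → Fin 7, (∏ a, Q (i a) (j a)) * D (f ∘ j) := by
    intro D i
    have : e ∘ i = fun a => ∑ j, Q (i a) j • f j := funext fun a => hexp (i a)
    rw [this, D.map_sum]
    exact Finset.sum_congr rfl fun j _ => D.map_smul_univ _ _
  have hdelta : ∀ j j' : Fin k → Fin 7,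
      ∑ i : Fin k → Fin 7, (∏ a, Q (i a) (j a)) * ∏ a, Q (i a) (j' a)
        = if j = j' then 1 else 0 := by
    intro j j'
    simp_rw [← Finset.prod_mul_distrib]
    rw [← Fintype.piFinset_univ,
      ← Finset.prod_univ_sum (fun _ => Finset.univ) fun a i => Q i (j a) * Q i (j' a)]
    simp_rw [hcol]
    by_cases h : j = j'
    · simp [h]
    · rw [if_neg h]
      obtain ⟨a, ha⟩ := Function.ne_iff.mp h
      exact Finset.prod_eq_zero (Finset.mem_univ a) (if_neg ha)
  calc ∑ i : Fin k → Fin 7, B (e ∘ i) * C (e ∘ i)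
      = ∑ i : Fin k → Fin 7, ∑ j : Fin k → Fin 7, ∑ j' : Fin k → Fin 7,
          ((∏ a, Q (i a) (j a)) * ∏ a, Q (i a) (j' a)) * (B (f ∘ j) * C (f ∘ j')) := by
        refine Finset.sum_congr rfl fun i _ => ?_
        rw [hmul B, hmul C, Finset.sum_mul_sum]
        exact Finset.sum_congr rfl fun j _ => Finset.sum_congr rfl fun j' _ => by ring
    _ = ∑ j : Fin k → Fin 7, ∑ j' : Fin k → Fin 7, (∑ i : Fin k → Fin 7,
          (∏ a, Q (i a) (j a)) * ∏ a, Q (i a) (j' a)) * (B (f ∘ j) * C (f ∘ j')) := by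
        rw [Finset.sum_comm]
        refine Finset.sum_congr rfl fun j _ => ?_
        rw [Finset.sum_comm]
        exact Finset.sum_congr rfl fun j' _ => (Finset.sum_mul ..).symm
    _ = _ := by
        simp_rw [hdelta]
        simp

/-- The value of `insertVectors h β a` at a fixed `w` is multilinear in the inserted vectors `a`. -/
theorem exists_insertVectors_multilinear {k m n : ℕ} (h : k + m = n) (β : V [⋀^Fin n]→ₗ[ℝ] ℝ)
    (w : Fin m → V) : ∃ C : MultilinearMap ℝ (fun _ : Fin k => V) ℝ,
      ∀ a, C a = insertVectors h β a w := by
  subst h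
  let C := ((β.toMultilinearMap.domDomCongr finSumFinEquiv.symm).currySum)
  refine ⟨⟨fun a => C a w, ?_, ?_⟩, ?_⟩
  · intro _ a i x y
    rw [C.map_update_add]; rfl
  · intro _ a i c x
    rw [C.map_update_smul]; rfl
  · intro a
    change β _ = β _
    congr 1
    funext l
    refine Fin.addCases (fun l => ?_) (fun l => ?_) l <;> simp

theorem basis_det_mul_self (hf : ∀ i j, frameInner e (f i) (f j) = if i = j then 1 else 0) :
    e.det f * e.det f = 1 := by
  have h : (e.toMatrix f).transpose * e.toMatrix f = 1 := by
    ext i j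
    rw [Matrix.mul_apply, Matrix.one_apply, ← hf i j]
    rfl
  have := congrArg Matrix.det h
  rw [Matrix.det_mul, Matrix.det_transpose, Matrix.det_one] at this
  rw [Module.Basis.det_apply]
  exact this

/-- An orthonormal basis defines the same Hodge star, up to the sign of its orientation. -/
theorem hodgeStar_orthonormal (hf : ∀ i j, frameInner e (f i) (f j) = if i = j then 1 else 0)
    {k m : ℕ} (h : k + m = 7) (α : V [⋀^Fin k]→ₗ[ℝ] ℝ) :
    hodgeStar e h α = e.det f • hodgeStar f h α := by
  ext w
  obtain ⟨C, hC⟩ := exists_insertVectors_multilinear (k := k) h e.det w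
  have happly : ∀ b : Module.Basis (Fin 7) ℝ V, hodgeStar b h α w = (1 / (k.factorial : ℝ)) *
      ∑ i : Fin k → Fin 7, α (b ∘ i) * insertVectors h b.det (b ∘ i) w := by
    intro b
    rw [hodgeStar, AlternatingMap.smul_apply, smul_eq_mul, sum_form_apply]
    rfl
  have hsum := sum_multilinear_orthonormal hf α.toMultilinearMap C
  simp only [hC, AlternatingMap.coe_multilinearMap] at hsum
  rw [AlternatingMap.smul_apply, happly, happly, hsum, smul_eq_mul, mul_left_comm]
  congr 1
  rw [Finset.mul_sum]
  refine Finset.sum_congr rfl fun i _ => ?_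
  have hdet : ∀ v, e.det v = e.det f * f.det v := fun v => by
    conv_lhs => rw [AlternatingMap.eq_smul_basis_det f e.det]
    rfl
  rw [insertVectors_apply, insertVectors_apply, hdet]
  ring

end Frames

/-! ### The exterior derivative on a Lie algebra with an abelian ideal -/

section AbelianIdeal

variable {g : Type*} [LieRing g] [LieAlgebra ℝ g]

theorem formAction_apply {V : Type*} [AddCommGroup V] [Module ℝ V] {k : ℕ} (A : Module.End ℝ V)
    (α : V [⋀^Fin k]→ₗ[ℝ] ℝ) (v : Fin k → V) :
    formAction A α v = -∑ i, α (Function.update v i (A (v i))) :=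
  rfl

theorem restrictForm_apply {k : ℕ} (h : LieIdeal ℝ g) (α : g [⋀^Fin k]→ₗ[ℝ] ℝ) (v : Fin k → h) :
    restrictForm h α v = α fun i => (v i : g) :=
  rfl

theorem extD_apply {k : ℕ} (α : g [⋀^Fin k]→ₗ[ℝ] ℝ) (v : Fin (k + 1) → g) :
    extD α v = (1 / 2 : ℝ) * ∑ i : Fin (k + 1), (-1 : ℝ) ^ (i : ℕ) *
      formAction (LieAlgebra.ad ℝ g (v i)) α (i.removeNth v) := by
  rw [extD, AlternatingMap.smul_apply, AlternatingMap.alternatizeUncurryFin_apply, smul_eq_mul]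
  congr 1
  refine Finset.sum_congr rfl fun i _ => ?_
  rw [zsmul_eq_mul]
  push_cast
  rfl

variable {h : LieIdeal ℝ g} (hab : ∀ u ∈ h, ∀ v ∈ h, ⁅u, v⁆ = 0)
include hab

theorem extD_apply_of_mem {k : ℕ} (α : g [⋀^Fin k]→ₗ[ℝ] ℝ) (v : Fin (k + 1) → g)
    (hv : ∀ i, v i ∈ h) : extD α v = 0 := by
  rw [extD_apply, Finset.sum_eq_zero, mul_zero]
  intro i _
  rw [formAction_apply, Finset.sum_eq_zero, neg_zero, mul_zero]
  intro j _
  refine α.map_coord_zero j ?_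
  rw [Function.update_self, LieAlgebra.ad_apply]
  exact hab _ (hv _) _ (hv _)

/-- For vectors of an abelian ideal, `(dα)(x, v₁, …, v_k) = (ϑ(ad x)α)(v₁, …, v_k)`. -/
theorem extD_apply_cons {k : ℕ} (α : g [⋀^Fin (k + 1)]→ₗ[ℝ] ℝ) (x : g) (v : Fin (k + 1) → h) :
    extD α (Fin.cons x fun i => (v i : g))
      = formAction (LieModule.toEnd ℝ g h x) (restrictForm h α) v := by
  set w : Fin (k + 1) → g := fun i => (v i : g) with hw
  have hwh : ∀ i, w i ∈ h := fun i => (v i).2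
  have hleft : formAction (LieModule.toEnd ℝ g h x) (restrictForm h α) v
      = formAction (LieAlgebra.ad ℝ g x) α w := by
    rw [formAction_apply, formAction_apply]
    congr 1
    refine Finset.sum_congr rfl fun i _ => ?_
    rw [restrictForm_apply]
    congr 1
    funext j
    by_cases hj : j = i
    · subst hj
      simp [hw]
    · simp [hw, Function.update_of_ne hj]
  have hterm : ∀ i : Fin (k + 1), (-1 : ℝ) ^ (i.succ : ℕ) *
      formAction (LieAlgebra.ad ℝ g (w i)) α (i.succ.removeNth (Fin.cons x w : Fin (k + 2) → g))
        = -α (Function.update w i ⁅x, w i⁆) := by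
    intro i
    have hrem : i.succ.removeNth (Fin.cons x w : Fin (k + 2) → g)
        = (Fin.cons x (i.removeNth w) : Fin (k + 1) → g) := by
      funext j
      refine Fin.cases ?_ (fun j => ?_) j
      · simp [Fin.removeNth]
      · simp [Fin.removeNth, Fin.succ_succAbove_succ]
    rw [hrem, formAction_apply, Fin.sum_univ_succ, Finset.sum_eq_zero, add_zero]
    · have hu : Function.update (Fin.cons x (i.removeNth w) : Fin (k + 1) → g) 0
          ((LieAlgebra.ad ℝ g (w i)) ((Fin.cons x (i.removeNth w) : Fin (k + 1) → g) 0))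
          = Matrix.vecCons (-⁅x, w i⁆) (i.removeNth w) := by
        rw [Fin.cons_zero, LieAlgebra.ad_apply, lie_skew, Fin.update_cons_zero]
        rfl
      have hins := α.map_insertNth i ⁅x, w i⁆ (i.removeNth w)
      rw [Fin.insertNth_removeNth] at hins
      rw [hu, hins]
      have hneg : α (Matrix.vecCons (-⁅x, w i⁆) (i.removeNth w))
          = -α (Matrix.vecCons ⁅x, w i⁆ (i.removeNth w)) := by
        have := α.map_vecCons_smul (i.removeNth w) (-1 : ℝ) ⁅x, w i⁆
        simpa using this
      rw [hneg, zsmul_eq_mul, Fin.val_succ, pow_succ]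
      push_cast
      ring
    · intro j _
      refine α.map_coord_zero j.succ ?_
      rw [Function.update_self, LieAlgebra.ad_apply, Fin.cons_succ]
      exact hab _ (hwh _) _ (hwh _)
  rw [hleft, extD_apply, Fin.sum_univ_succ]
  simp only [Fin.cons_zero, Fin.cons_succ, hterm]
  have h0 : (0 : Fin (k + 2)).removeNth (Fin.cons x w : Fin (k + 2) → g) = w := by
    funext j
    simp [Fin.removeNth]
  rw [h0, Finset.sum_neg_distrib]
  have h1 : formAction (LieAlgebra.ad ℝ g x) α w = -∑ i, α (Function.update w i ⁅x, w i⁆) := rfl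
  rw [← h1, Fin.val_zero, pow_zero]
  ring

end AbelianIdeal

/-! ### The square of a 2-form -/

section Square

variable {W : Type*} [AddCommGroup W] [Module ℝ W]

theorem form_two_swap (ω : W [⋀^Fin 2]→ₗ[ℝ] ℝ) (a b : W) : ω ![a, b] = -ω ![b, a] := by
  rw [← ω.map_swap ![b, a] (i := 0) (j := 1) (by decide)]
  congr 1
  funext t; fin_cases t <;> rfl

/-- The 4-form `ω ∧ ω / 2`. -/
def halfSquare (ω : W [⋀^Fin 2]→ₗ[ℝ] ℝ) : W [⋀^Fin 4]→ₗ[ℝ] ℝ where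
  toFun v := ω ![v 0, v 1] * ω ![v 2, v 3] - ω ![v 0, v 2] * ω ![v 1, v 3]
    + ω ![v 0, v 3] * ω ![v 1, v 2]
  map_update_add' {inst} v i x y := by
    obtain rfl : inst = instDecidableEqFin 4 := Subsingleton.elim _ _
    have hl : ∀ a b c, ω ![a + b, c] = ω ![a, c] + ω ![b, c] := fun a b c =>
      ω.map_vecCons_add ![c] a b
    have hr : ∀ a b c, ω ![c, a + b] = ω ![c, a] + ω ![c, b] := fun a b c => by
      rw [form_two_swap ω c, hl, form_two_swap ω c a, form_two_swap ω c b, neg_add]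
    fin_cases i <;> simp [Function.update, hl, hr] <;> ring
  map_update_smul' {inst} v i c x := by
    obtain rfl : inst = instDecidableEqFin 4 := Subsingleton.elim _ _
    have hl : ∀ a b, ω ![c • a, b] = c * ω ![a, b] := fun a b =>
      ω.map_vecCons_smul ![b] c a
    have hr : ∀ a b, ω ![b, c • a] = c * ω ![b, a] := fun a b => by
      rw [form_two_swap ω b, hl, form_two_swap ω b a, mul_neg]
    fin_cases i <;> simp [Function.update, hl, hr] <;> ring
  map_eq_zero_of_eq' v i j hv hij := by
    have h0 : ∀ a, ω ![a, a] = 0 := fun a => ω.map_eq_zero_of_eq ![a, a] (i := 0) (j := 1) rfl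
      (by decide)
    fin_cases i <;> fin_cases j <;> first
      | exact absurd rfl hij
      | (simp only [Fin.zero_eta, Fin.mk_one, Fin.reduceFinMk] at hv
         simp only [hv, h0, form_two_swap ω (v 1) (v 0), form_two_swap ω (v 2) (v 0),
          form_two_swap ω (v 2) (v 1), form_two_swap ω (v 3) (v 1),
          form_two_swap ω (v 3) (v 2)]
         ring)

theorem formAction_two (A : Module.End ℝ W) (ω : W [⋀^Fin 2]→ₗ[ℝ] ℝ) (p q : W) :
    formAction A ω ![p, q] = -(ω ![A p, q] + ω ![p, A q]) := by
  rw [formAction_apply, Fin.sum_univ_two]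
  congr 3 <;> (funext t; fin_cases t <;> rfl)

theorem formAction_three (A : Module.End ℝ W) (α : W [⋀^Fin 3]→ₗ[ℝ] ℝ) (p q r : W) :
    formAction A α ![p, q, r] = -(α ![A p, q, r] + α ![p, A q, r] + α ![p, q, A r]) := by
  rw [formAction_apply, Fin.sum_univ_three]
  congr 3 <;> congr 1 <;> (funext t; fin_cases t <;> rfl)

theorem formAction_four (A : Module.End ℝ W) (α : W [⋀^Fin 4]→ₗ[ℝ] ℝ) (p q r s : W) :
    formAction A α ![p, q, r, s] = -(α ![A p, q, r, s] + α ![p, A q, r, s] + α ![p, q, A r, s]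
      + α ![p, q, r, A s]) := by
  rw [formAction_apply, Fin.sum_univ_four]
  congr 3 <;> congr 1 <;> (try congr 1) <;> (funext t; fin_cases t <;> rfl)

theorem halfSquare_apply (ω : W [⋀^Fin 2]→ₗ[ℝ] ℝ) (p q r s : W) :
    halfSquare ω ![p, q, r, s]
      = ω ![p, q] * ω ![r, s] - ω ![p, r] * ω ![q, s] + ω ![p, s] * ω ![q, r] :=
  rfl

/-- `ϑ(A)(ω ∧ ω / 2) = ω ∧ ϑ(A)ω`. -/
theorem formAction_halfSquare (A : Module.End ℝ W) (ω : W [⋀^Fin 2]→ₗ[ℝ] ℝ) (p q r s : W) :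
    formAction A (halfSquare ω) ![p, q, r, s]
      = formAction A ω ![p, q] * ω ![r, s] - formAction A ω ![p, r] * ω ![q, s]
        + formAction A ω ![p, s] * ω ![q, r] + formAction A ω ![r, s] * ω ![p, q]
        - formAction A ω ![q, s] * ω ![p, r] + formAction A ω ![q, r] * ω ![p, s] := by
  simp only [formAction_two, formAction_four, halfSquare_apply]
  ring

end Square

/-! ### The linear algebra of `SU(3)`-structures -/

section StandardSU3

/-- The coefficients `ω(bᵢ, bⱼ)` of `b⁰¹ + b²³ + b⁴⁵`. -/
def omegaCoeff (i j : Fin 6) : ℤ :=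
  if i.val / 2 = j.val / 2 then (j.val : ℤ) - i.val else 0

/-- The sign of the permutation `(p, q, r)` of `(0, 1, 2)`, and `0` if two indices coincide. -/
def leviCivita (p q r : ℤ) : ℤ :=
  (q - p) * (r - p) * (r - q) / 2

/-- The coefficients on `bᵢ, bⱼ, b_k` of the real part of the complex volume form
`(b⁰ + i b¹) ∧ (b² + i b³) ∧ (b⁴ + i b⁵)`. -/
def reCoeff (i j k : Fin 6) : ℤ :=
  leviCivita (i.val / 2 : ℕ) (j.val / 2 : ℕ) (k.val / 2 : ℕ)
    * (if i.val % 2 + j.val % 2 + k.val % 2 = 0 then 1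
      else if i.val % 2 + j.val % 2 + k.val % 2 = 2 then -1 else 0)

/-- The coefficients on `bᵢ, bⱼ, b_k` of the imaginary part of the complex volume form
`(b⁰ + i b¹) ∧ (b² + i b³) ∧ (b⁴ + i b⁵)`. -/
def imCoeff (i j k : Fin 6) : ℤ :=
  leviCivita (i.val / 2 : ℕ) (j.val / 2 : ℕ) (k.val / 2 : ℕ)
    * (if i.val % 2 + j.val % 2 + k.val % 2 = 1 then 1
      else if i.val % 2 + j.val % 2 + k.val % 2 = 3 then -1 else 0)

/-- The `n`-th (from `n = 0` on) of the indices that do not occur in `s`, in increasing order. -/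
def complIndex (s : List (Fin 6)) (n : ℕ) : Fin 6 :=
  ((List.finRange 6).filter fun t => t ∉ s).getD n 0

/-- The sign of `(6, c₀, c₁, c₂, i, j, k)`, where the `c`'s are the indices complementary to
`i`, `j`, `k` in `0, …, 5`. It is the sign with which the seven-dimensional Hodge star of `x♭ ∧ α`
restricts to the Hodge star of `α` on `h`. -/
def complSign (i j k : Fin 6) : ℤ :=
  indexSign ![6, (complIndex [i, j, k] 0).castSucc, (complIndex [i, j, k] 1).castSucc,
    (complIndex [i, j, k] 2).castSucc, i.castSucc, j.castSucc, k.castSucc]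

variable {W : Type*} [AddCommGroup W] [Module ℝ W] (b : Module.Basis (Fin 6) ℝ W)

theorem form_update_expand {k : ℕ} (α : W [⋀^Fin k]→ₗ[ℝ] ℝ) (v : Fin k → W) (t : Fin k) (y : W) :
    α (Function.update v t y) = ∑ l, b.repr y l * α (Function.update v t (b l)) := by
  conv_lhs => rw [← b.sum_repr y, α.map_update_sum]
  exact Finset.sum_congr rfl fun l _ => by rw [α.map_update_smul, smul_eq_mul]

theorem formAction_two_basis (A : Module.End ℝ W) (α : W [⋀^Fin 2]→ₗ[ℝ] ℝ) (i j : Fin 6) :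
    formAction A α ![b i, b j]
      = -∑ l, (b.repr (A (b i)) l * α ![b l, b j] + b.repr (A (b j)) l * α ![b i, b l]) := by
  have h0 : ∀ p q x : W, Function.update ![p, q] 0 x = ![x, q] := fun p q x => by
    funext t; fin_cases t <;> rfl
  have h1 : ∀ p q x : W, Function.update ![p, q] 1 x = ![p, x] := fun p q x => by
    funext t; fin_cases t <;> rfl
  have e0 := form_update_expand b α ![b i, b j] 0 (A (b i))
  have e1 := form_update_expand b α ![b i, b j] 1 (A (b j))
  simp only [h0, h1] at e0 e1
  rw [formAction_two, e0, e1, ← Finset.sum_add_distrib]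

theorem formAction_three_basis (A : Module.End ℝ W) (α : W [⋀^Fin 3]→ₗ[ℝ] ℝ) (i j k : Fin 6) :
    formAction A α ![b i, b j, b k]
      = -∑ l, (b.repr (A (b i)) l * α ![b l, b j, b k] + b.repr (A (b j)) l * α ![b i, b l, b k]
          + b.repr (A (b k)) l * α ![b i, b j, b l]) := by
  have h0 : ∀ p q r x : W, Function.update ![p, q, r] 0 x = ![x, q, r] := fun p q r x => by
    funext t; fin_cases t <;> rfl
  have h1 : ∀ p q r x : W, Function.update ![p, q, r] 1 x = ![p, x, r] := fun p q r x => by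
    funext t; fin_cases t <;> rfl
  have h2 : ∀ p q r x : W, Function.update ![p, q, r] 2 x = ![p, q, x] := fun p q r x => by
    funext t; fin_cases t <;> rfl
  have e0 := form_update_expand b α ![b i, b j, b k] 0 (A (b i))
  have e1 := form_update_expand b α ![b i, b j, b k] 1 (A (b j))
  have e2 := form_update_expand b α ![b i, b j, b k] 2 (A (b k))
  simp only [h0, h1, h2] at e0 e1 e2
  rw [formAction_three, e0, e1, e2, ← Finset.sum_add_distrib, ← Finset.sum_add_distrib]

theorem repr_apply_eq_sum (A : Module.End ℝ W) (y : W) (i : Fin 6) :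
    b.repr (A y) i = ∑ j, b.repr y j * b.repr (A (b j)) i := by
  conv_lhs => rw [← b.sum_repr y, map_sum, map_sum]
  simp

/-- The adjoint of `ϑ(A)` for the inner product of 3-forms is `ϑ(Aᵀ)`. -/
theorem sum_mul_formAction (A B : Module.End ℝ W)
    (hB : ∀ i j, b.repr (B (b i)) j = b.repr (A (b j)) i) (α β : W [⋀^Fin 3]→ₗ[ℝ] ℝ) :
    ∑ i, ∑ j, ∑ k, α ![b i, b j, b k] * formAction A β ![b i, b j, b k]
      = ∑ i, ∑ j, ∑ k, formAction B α ![b i, b j, b k] * β ![b i, b j, b k] := by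
  simp only [formAction_three_basis b, hB, mul_neg, neg_mul, Finset.sum_neg_distrib,
    Finset.mul_sum, Finset.sum_mul, mul_add, add_mul, Finset.sum_add_distrib]
  have s3 : ∀ F : Fin 6 → Fin 6 → Fin 6 → ℝ,
      ∑ j, ∑ k, ∑ l, F j k l = ∑ j, ∑ k, ∑ l, F l k j := by
    intro F
    simp_rw [Finset.sum_comm (f := fun k l => F _ k l)]
    rw [Finset.sum_comm]
    exact Finset.sum_congr rfl fun l _ => Finset.sum_comm
  have s4 : ∀ F : Fin 6 → Fin 6 → Fin 6 → Fin 6 → ℝ,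
      ∑ i, ∑ j, ∑ k, ∑ l, F i j k l = ∑ i, ∑ j, ∑ k, ∑ l, F l j k i := by
    intro F
    rw [Finset.sum_comm]
    simp_rw [s3 fun i k l => F i _ k l]
    rw [Finset.sum_comm]
  congr 1
  congr 1
  · congr 1
    · rw [s4]
      refine Finset.sum_congr rfl fun i _ => Finset.sum_congr rfl fun j _ =>
        Finset.sum_congr rfl fun k _ => Finset.sum_congr rfl fun l _ => ?_
      ring
    · refine Finset.sum_congr rfl fun i _ => ?_
      rw [s3]
      refine Finset.sum_congr rfl fun j _ =>
        Finset.sum_congr rfl fun k _ => Finset.sum_congr rfl fun l _ => ?_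
      ring
  · refine Finset.sum_congr rfl fun i _ => Finset.sum_congr rfl fun j _ => ?_
    rw [Finset.sum_comm]
    refine Finset.sum_congr rfl fun k _ => Finset.sum_congr rfl fun l _ => ?_
    ring

variable {b} {ω : W [⋀^Fin 2]→ₗ[ℝ] ℝ}

/-- Lefschetz: `γ ↦ ω ∧ γ` is injective on 2-forms in dimension six. -/
theorem formAction_eq_zero_of_halfSquare (hω : ∀ i j, ω ![b i, b j] = omegaCoeff i j)
    (A : Module.End ℝ W) (hA : formAction A (halfSquare ω) = 0) : formAction A ω = 0 := by
  have H := fun p q r s : Fin 6 => formAction_halfSquare A ω (b p) (b q) (b r) (b s)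
  simp only [hA, AlternatingMap.zero_apply, hω] at H
  refine ext_alternating_strictMono b fun v hv => ?_
  have hv2 : b ∘ v = ![b (v 0), b (v 1)] := by
    funext t; fin_cases t <;> rfl
  have h01 : v 0 < v 1 := hv (by decide)
  rw [hv2, AlternatingMap.zero_apply]
  generalize v 0 = i at *
  generalize v 1 = j at *
  -- An index pair is complementary to one or two of the complex lines `{0, 1}`, `{2, 3}`, `{4, 5}`.
  have e1 := H i j 0 1
  have e2 := H i j 2 3
  have e3 := H i j 4 5
  have e4 := H 0 1 2 3
  have e5 := H 0 1 4 5
  have e6 := H 2 3 4 5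
  clear hv hv2
  fin_cases i <;> fin_cases j <;> first
    | exact absurd h01 (by decide)
    | (norm_num [omegaCoeff] at e1 e2 e3 e4 e5 e6 ⊢
       linarith)

/-- The coefficients of the matrix entry `A p q` in `⋆ϑ(A) Re Ω = -ϑ(Aᵀ) Im Ω - (tr A) Im Ω`,
evaluated at `bᵢ, bⱼ, b_k`. -/
theorem star_re_eq_im : ∀ i j k : Fin 6, i < j → j < k → ∀ p q : Fin 6,
    complSign i j k *
      -((if q = complIndex [i, j, k] 0 then
            reCoeff p (complIndex [i, j, k] 1) (complIndex [i, j, k] 2) else 0)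
        + (if q = complIndex [i, j, k] 1 then
            reCoeff (complIndex [i, j, k] 0) p (complIndex [i, j, k] 2) else 0)
        + (if q = complIndex [i, j, k] 2 then
            reCoeff (complIndex [i, j, k] 0) (complIndex [i, j, k] 1) p else 0))
      = (if p = i then imCoeff q j k else 0) + (if p = j then imCoeff i q k else 0)
        + (if p = k then imCoeff i j q else 0) - imCoeff i j k * (if p = q then 1 else 0) := by
  decide +kernel

/-- The Hodge star of `ϑ(A) Re Ω` equals `-ϑ(Aᵀ) Im Ω` if `A` is trace-free. -/
theorem star_formAction_re {ρ ψ β : W [⋀^Fin 3]→ₗ[ℝ] ℝ} {A B : Module.End ℝ W}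
    (hρ : ∀ i j k, ρ ![b i, b j, b k] = reCoeff i j k)
    (hψ : ∀ i j k, ψ ![b i, b j, b k] = imCoeff i j k)
    (hβ : ∀ i j k, i < j → j < k → β ![b i, b j, b k] = complSign i j k *
      formAction A ρ
        ![b (complIndex [i, j, k] 0), b (complIndex [i, j, k] 1), b (complIndex [i, j, k] 2)])
    (hB : ∀ i j, b.repr (B (b i)) j = b.repr (A (b j)) i)
    (htr : ∑ i, b.repr (A (b i)) i = 0) :
    β = -formAction B ψ := by
  refine ext_alternating_strictMono b fun v hv => ?_
  have hv3 : b ∘ v = ![b (v 0), b (v 1), b (v 2)] := by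
    funext t; fin_cases t <;> rfl
  have h01 : v 0 < v 1 := hv (by decide)
  have h12 : v 1 < v 2 := hv (by decide)
  rw [hv3, AlternatingMap.neg_apply, hβ _ _ _ h01 h12]
  generalize v 0 = i at *
  generalize v 1 = j at *
  generalize v 2 = k at *
  have key := star_re_eq_im i j k h01 h12
  generalize complSign i j k = s at *
  generalize complIndex [i, j, k] 0 = c₀ at *
  generalize complIndex [i, j, k] 1 = c₁ at *
  generalize complIndex [i, j, k] 2 = c₂ at *
  -- Both sides are linear in the matrix of `A`, so it suffices to compare the coefficients.
  set a : Fin 6 → Fin 6 → ℝ := fun p q => b.repr (A (b q)) p with ha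
  have hcol : ∀ (c : Fin 6) (w : Fin 6 → ℤ),
      ∑ l, a l c * (w l : ℝ) = ∑ p, ∑ q, a p q * ((if q = c then w p else 0 : ℤ) : ℝ) := by
    intro c w
    simp
  have hrow : ∀ (c : Fin 6) (w : Fin 6 → ℤ),
      ∑ l, a c l * (w l : ℝ) = ∑ p, ∑ q, a p q * ((if p = c then w q else 0 : ℤ) : ℝ) := by
    intro c w
    rw [Finset.sum_comm]
    simp
  have htr' : (0 : ℝ) = ∑ p, ∑ q, a p q * ((if p = q then 1 else 0 : ℤ) : ℝ) := by
    rw [← htr]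
    simp [ha]
  have hL : formAction A ρ ![b c₀, b c₁, b c₂] = -∑ p, ∑ q, a p q *
      (((if q = c₀ then reCoeff p c₁ c₂ else 0) + (if q = c₁ then reCoeff c₀ p c₂ else 0)
        + (if q = c₂ then reCoeff c₀ c₁ p else 0) : ℤ) : ℝ) := by
    simp only [formAction_three_basis b, hρ]
    simp only [Int.cast_add, mul_add, Finset.sum_add_distrib, ← hcol]
    rfl
  have hR : formAction B ψ ![b i, b j, b k] = -∑ p, ∑ q, a p q *
      (((if p = i then imCoeff q j k else 0) + (if p = j then imCoeff i q k else 0)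
        + (if p = k then imCoeff i j q else 0) : ℤ) : ℝ) := by
    simp only [formAction_three_basis b, hψ, hB]
    simp only [Int.cast_add, mul_add, Finset.sum_add_distrib, ← hrow]
    rfl
  have h0 : (0 : ℝ) = ∑ p, ∑ q, a p q * ((imCoeff i j k * (if p = q then 1 else 0) : ℤ) : ℝ) := by
    rw [← mul_zero (imCoeff i j k : ℝ), htr', Finset.mul_sum]
    refine Finset.sum_congr rfl fun p _ => ?_
    rw [Finset.mul_sum]
    refine Finset.sum_congr rfl fun q _ => ?_
    push_cast
    ring
  rw [hL, hR, neg_neg]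
  refine Eq.trans ?_ (sub_zero _)
  rw [h0]
  simp only [← Finset.sum_neg_distrib, Finset.mul_sum, ← Finset.sum_sub_distrib]
  refine Finset.sum_congr rfl fun p _ => Finset.sum_congr rfl fun q _ => ?_
  rw [← mul_sub, ← Int.cast_sub, ← key p q]
  push_cast
  ring

/-- If `ϑ(A)β = 0` for `β = ⋆ϑ(A) Re Ω`, then `ϑ(Aᵀ) Im Ω = 0`, since
`0 = ⟨ϑ(A)β, Im Ω⟩ = -|ϑ(Aᵀ) Im Ω|²`. -/
theorem formAction_transpose_eq_zero {ψ β : W [⋀^Fin 3]→ₗ[ℝ] ℝ} {A B : Module.End ℝ W}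
    (hB : ∀ i j, b.repr (B (b i)) j = b.repr (A (b j)) i) (hβ : β = -formAction B ψ)
    (hA : formAction A β = 0) : formAction B ψ = 0 := by
  have h := sum_mul_formAction b A B hB ψ β
  have hsq : ∑ i, ∑ j, ∑ k, formAction B ψ ![b i, b j, b k] * formAction B ψ ![b i, b j, b k]
      = 0 := by
    rw [hA, hβ] at h
    simp only [AlternatingMap.zero_apply, AlternatingMap.neg_apply, mul_zero, mul_neg,
      Finset.sum_const_zero, Finset.sum_neg_distrib] at h
    linarith
  have hz : ∀ i j k, formAction B ψ ![b i, b j, b k] = 0 := by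
    intro i j k
    rw [Finset.sum_eq_zero_iff_of_nonneg fun i _ => Finset.sum_nonneg fun j _ =>
      Finset.sum_nonneg fun k _ => mul_self_nonneg _] at hsq
    have h1 := hsq i (Finset.mem_univ i)
    rw [Finset.sum_eq_zero_iff_of_nonneg fun j _ =>
      Finset.sum_nonneg fun k _ => mul_self_nonneg _] at h1
    have h2 := h1 j (Finset.mem_univ j)
    rw [Finset.sum_eq_zero_iff_of_nonneg fun k _ => mul_self_nonneg _] at h2
    exact mul_self_eq_zero.mp (h2 k (Finset.mem_univ k))
  refine ext_alternating_strictMono b fun v _ => ?_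
  have hv3 : b ∘ v = ![b (v 0), b (v 1), b (v 2)] := by
    funext t; fin_cases t <;> rfl
  rw [hv3, hz, AlternatingMap.zero_apply]

theorem trace_eq_zero_of_symplectic (hω : ∀ i j, ω ![b i, b j] = omegaCoeff i j)
    {A : Module.End ℝ W} (hA : formAction A ω = 0) : ∑ i, b.repr (A (b i)) i = 0 := by
  have H := fun i j : Fin 6 => formAction_two_basis b A ω i j
  simp only [hA, AlternatingMap.zero_apply, hω, Fin.sum_univ_six] at H
  have e0 := H 0 1
  have e1 := H 2 3
  have e2 := H 4 5
  norm_num [omegaCoeff] at e0 e1 e2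
  rw [Fin.sum_univ_six]
  linarith

/-- An endomorphism which preserves `ω`, and whose transpose preserves `Im Ω`, is
skew-symmetric. In `2 × 2` blocks these are small linear systems, which are solved block by
block. -/
theorem skew_of_symplectic {ψ : W [⋀^Fin 3]→ₗ[ℝ] ℝ} (hω : ∀ i j, ω ![b i, b j] = omegaCoeff i j)
    (hψ : ∀ i j k, ψ ![b i, b j, b k] = imCoeff i j k) {A B : Module.End ℝ W}
    (hB : ∀ i j, b.repr (B (b i)) j = b.repr (A (b j)) i)
    (hA : formAction A ω = 0) (hψB : formAction B ψ = 0) (i j : Fin 6) :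
    b.repr (A (b j)) i = -b.repr (A (b i)) j := by
  have H := fun i j : Fin 6 => formAction_two_basis b A ω i j
  have K := fun i j k : Fin 6 => formAction_three_basis b B ψ i j k
  simp only [hA, AlternatingMap.zero_apply, hω, Fin.sum_univ_six] at H
  simp only [hψB, AlternatingMap.zero_apply, hψ, hB, Fin.sum_univ_six] at K
  -- The blocks of one complex line.
  have hdiag : b.repr (A (b 0)) 0 = 0
      ∧ b.repr (A (b 1)) 1 = 0
      ∧ b.repr (A (b 2)) 2 = 0
      ∧ b.repr (A (b 3)) 3 = 0
      ∧ b.repr (A (b 4)) 4 = 0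
      ∧ b.repr (A (b 5)) 5 = 0
      ∧ b.repr (A (b 1)) 0 = -b.repr (A (b 0)) 1
      ∧ b.repr (A (b 3)) 2 = -b.repr (A (b 2)) 3
      ∧ b.repr (A (b 5)) 4 = -b.repr (A (b 4)) 5 := by
    have e01 := H 0 1
    have e23 := H 2 3
    have e45 := H 4 5
    have k024 := K 0 2 4
    have k025 := K 0 2 5
    have k034 := K 0 3 4
    have k035 := K 0 3 5
    have k124 := K 1 2 4
    have k125 := K 1 2 5
    have k134 := K 1 3 4
    have k135 := K 1 3 5
    clear H K
    norm_num [omegaCoeff, imCoeff, leviCivita] at e01 e23 e45 k024 k025 k034 k035 k124 k125 k134 k135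
    refine ⟨?_, ?_, ?_, ?_, ?_, ?_, ?_, ?_, ?_⟩ <;> linarith
  -- The blocks of the lines `{0, 1}` and `{2, 3}`.
  have h01 : b.repr (A (b 2)) 0 = -b.repr (A (b 0)) 2
      ∧ b.repr (A (b 3)) 0 = -b.repr (A (b 0)) 3
      ∧ b.repr (A (b 2)) 1 = -b.repr (A (b 1)) 2
      ∧ b.repr (A (b 3)) 1 = -b.repr (A (b 1)) 3 := by
    have e02 := H 0 2
    have e03 := H 0 3
    have e12 := H 1 2
    have e13 := H 1 3
    have k014 := K 0 1 4
    have k015 := K 0 1 5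
    have k234 := K 2 3 4
    have k235 := K 2 3 5
    clear H K
    norm_num [omegaCoeff, imCoeff, leviCivita] at e02 e03 e12 e13 k014 k015 k234 k235
    refine ⟨?_, ?_, ?_, ?_⟩ <;> linarith
  -- The blocks of the lines `{0, 1}` and `{4, 5}`.
  have h02 : b.repr (A (b 4)) 0 = -b.repr (A (b 0)) 4
      ∧ b.repr (A (b 5)) 0 = -b.repr (A (b 0)) 5
      ∧ b.repr (A (b 4)) 1 = -b.repr (A (b 1)) 4
      ∧ b.repr (A (b 5)) 1 = -b.repr (A (b 1)) 5 := by
    have e04 := H 0 4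
    have e05 := H 0 5
    have e14 := H 1 4
    have e15 := H 1 5
    have k012 := K 0 1 2
    have k013 := K 0 1 3
    have k245 := K 2 4 5
    have k345 := K 3 4 5
    clear H K
    norm_num [omegaCoeff, imCoeff, leviCivita] at e04 e05 e14 e15 k012 k013 k245 k345
    refine ⟨?_, ?_, ?_, ?_⟩ <;> linarith
  -- The blocks of the lines `{2, 3}` and `{4, 5}`.
  have h12 : b.repr (A (b 4)) 2 = -b.repr (A (b 2)) 4
      ∧ b.repr (A (b 5)) 2 = -b.repr (A (b 2)) 5
      ∧ b.repr (A (b 4)) 3 = -b.repr (A (b 3)) 4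
      ∧ b.repr (A (b 5)) 3 = -b.repr (A (b 3)) 5 := by
    have e24 := H 2 4
    have e25 := H 2 5
    have e34 := H 3 4
    have e35 := H 3 5
    have k023 := K 0 2 3
    have k123 := K 1 2 3
    have k045 := K 0 4 5
    have k145 := K 1 4 5
    clear H K
    norm_num [omegaCoeff, imCoeff, leviCivita] at e24 e25 e34 e35 k023 k123 k045 k145
    refine ⟨?_, ?_, ?_, ?_⟩ <;> linarith
  have hle : ∀ i j : Fin 6, i ≤ j → b.repr (A (b j)) i = -b.repr (A (b i)) j := by
    obtain ⟨d0, d1, d2, d3, d4, d5, d01, d23, d45⟩ := hdiag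
    obtain ⟨o02, o03, o12, o13⟩ := h01
    obtain ⟨o04, o05, o14, o15⟩ := h02
    obtain ⟨o24, o25, o34, o35⟩ := h12
    intro i j hij
    fin_cases i <;> fin_cases j <;> first
      | exact absurd hij (by decide)
      | assumption
      | (simp only [Fin.zero_eta, Fin.mk_one, Fin.reduceFinMk, d0, d1, d2, d3, d4, d5, neg_zero])
  rcases le_total i j with h | h
  · exact hle i j h
  · rw [hle j i h, neg_neg]

end StandardSU3

/-! ### The Laplacian of a coclosed `G₂`-structure -/

section Linear

variable {V : Type*} [AddCommGroup V] [Module ℝ V]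

theorem formAction_smul {k : ℕ} (A : Module.End ℝ V) (c : ℝ) (α : V [⋀^Fin k]→ₗ[ℝ] ℝ) :
    formAction A (c • α) = c • formAction A α := by
  ext v
  simp only [formAction_apply, AlternatingMap.smul_apply, smul_eq_mul, mul_neg, Finset.mul_sum]

theorem formAction_neg {k : ℕ} (A : Module.End ℝ V) (α : V [⋀^Fin k]→ₗ[ℝ] ℝ) :
    formAction (-A) α = -formAction A α := by
  ext v
  simp only [formAction_apply, LinearMap.neg_apply, AlternatingMap.neg_apply,
    ← Finset.sum_neg_distrib, AlternatingMap.map_update_neg]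

theorem hodgeStar_zero (e : Module.Basis (Fin 7) ℝ V) {k m : ℕ} (h : k + m = 7) :
    hodgeStar e h 0 = 0 := by
  simp [hodgeStar]

theorem extD_smul {g : Type*} [LieRing g] [LieAlgebra ℝ g] {k : ℕ} (c : ℝ)
    (α : g [⋀^Fin k]→ₗ[ℝ] ℝ) : extD (c • α) = c • extD α := by
  ext v
  simp only [extD_apply, formAction_smul, AlternatingMap.smul_apply, smul_eq_mul, Finset.mul_sum]
  exact Finset.sum_congr rfl fun i _ => by ring

theorem extD_zero {g : Type*} [LieRing g] [LieAlgebra ℝ g] {k : ℕ} :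
    extD (0 : g [⋀^Fin k]→ₗ[ℝ] ℝ) = 0 := by
  simpa using extD_smul (0 : ℝ) (0 : g [⋀^Fin k]→ₗ[ℝ] ℝ)

theorem codiff_zero {g : Type*} [LieRing g] [LieAlgebra ℝ g] (e : Module.Basis (Fin 7) ℝ g)
    {p m : ℕ} (h : p + 1 + m = 7) : codiff e h (0 : g [⋀^Fin (p + 1)]→ₗ[ℝ] ℝ) = 0 := by
  rw [codiff, hodgeStar_zero, extD_zero, hodgeStar_zero, smul_zero]

theorem codiff_of_even {g : Type*} [LieRing g] [LieAlgebra ℝ g] (e : Module.Basis (Fin 7) ℝ g)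
    {p m : ℕ} (h : p + 1 + m = 7) (hp : Even (p + 1)) (α : g [⋀^Fin (p + 1)]→ₗ[ℝ] ℝ) :
    codiff e h α
      = hodgeStar e (show m + 1 + p = 7 by omega) (extD (hodgeStar e h α)) := by
  rw [codiff, hp.neg_one_pow, one_smul]

theorem inducedPsi_apply {g : Type*} [LieRing g] [LieAlgebra ℝ g] (ϕ : g [⋀^Fin 4]→ₗ[ℝ] ℝ)
    (h : LieIdeal ℝ g) (x : g) (v : Fin 3 → h) :
    inducedPsi ϕ h x v = -ϕ (Matrix.vecCons x fun i => (v i : g)) :=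
  rfl

theorem inducedPsi_smul {g : Type*} [LieRing g] [LieAlgebra ℝ g] (c : ℝ)
    (ϕ : g [⋀^Fin 4]→ₗ[ℝ] ℝ) (h : LieIdeal ℝ g) (x : g) :
    inducedPsi (c • ϕ) h x = c • inducedPsi ϕ h x := by
  ext v
  rw [AlternatingMap.smul_apply, inducedPsi_apply, inducedPsi_apply, AlternatingMap.smul_apply,
    smul_neg]

/-- `Δ⋆φ = d⋆dφ` for a coclosed 3-form `φ`. -/
theorem laplacian4_hodgeStar {g : Type*} [LieRing g] [LieAlgebra ℝ g]
    (e : Module.Basis (Fin 7) ℝ g) (φ : g [⋀^Fin 3]→ₗ[ℝ] ℝ)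
    (hco : extD (hodgeStar e (m := 4) rfl φ) = 0) :
    laplacian4 e (hodgeStar e (m := 4) rfl φ)
      = extD (hodgeStar e (k := 4) (m := 3) rfl (extD φ)) := by
  rw [laplacian4, hco, codiff_zero, add_zero, codiff_of_even e (p := 3) (m := 3) rfl (by decide)]
  exact congrArg (fun β => extD (hodgeStar e (k := 4) (m := 3) rfl (extD β)))
    (hodgeStar_hodgeStar_three e φ)

end Linear

/-! ### The induced `SU(3)`-structure in an adapted frame -/

theorem modelCoeff_six : ∀ i j : Fin 6, modelCoeff 6 i.castSucc j.castSucc = omegaCoeff i j := by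
  decide

theorem modelCoeff_castSucc : ∀ i j k : Fin 6,
    modelCoeff i.castSucc j.castSucc k.castSucc = reCoeff i j k := by
  decide

theorem imCoeff_eq_zero : ∀ i j k : Fin 6, ¬Function.Injective ![i, j, k] → imCoeff i j k = 0 := by
  decide

/-- The components of `⋆φ` with one index equal to the last one. -/
theorem star_modelCoeff_last : ∀ i j k : Fin 6, Function.Injective ![i, j, k] →
    Function.Injective ![(complIndex [i, j, k] 0).castSucc, (complIndex [i, j, k] 1).castSucc,
      (complIndex [i, j, k] 2).castSucc, 6, i.castSucc, j.castSucc, k.castSucc] ∧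
    indexSign ![(complIndex [i, j, k] 0).castSucc, (complIndex [i, j, k] 1).castSucc,
      (complIndex [i, j, k] 2).castSucc, 6, i.castSucc, j.castSucc, k.castSucc]
      * reCoeff (complIndex [i, j, k] 0) (complIndex [i, j, k] 1) (complIndex [i, j, k] 2)
      = -imCoeff i j k := by
  decide +kernel

/-- The components of `⋆φ` without the last index. -/
theorem star_modelCoeff_four : ∀ i j k l : Fin 6, i < j → j < k → k < l →
    Function.Injective ![6, (complIndex [i, j, k, l] 0).castSucc,
      (complIndex [i, j, k, l] 1).castSucc, i.castSucc, j.castSucc, k.castSucc, l.castSucc] ∧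
    indexSign ![6, (complIndex [i, j, k, l] 0).castSucc,
      (complIndex [i, j, k, l] 1).castSucc, i.castSucc, j.castSucc, k.castSucc, l.castSucc]
      * omegaCoeff (complIndex [i, j, k, l] 0) (complIndex [i, j, k, l] 1)
      = omegaCoeff i j * omegaCoeff k l - omegaCoeff i k * omegaCoeff j l
        + omegaCoeff i l * omegaCoeff j k := by
  decide +kernel

theorem injective_complIndex : ∀ i j k : Fin 6, i < j → j < k →
    Function.Injective ![6, (complIndex [i, j, k] 0).castSucc, (complIndex [i, j, k] 1).castSucc,
      (complIndex [i, j, k] 2).castSucc, i.castSucc, j.castSucc, k.castSucc] := by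
  decide +kernel

section Frame

variable {g : Type*} [LieRing g] [LieAlgebra ℝ g] {f : Module.Basis (Fin 7) ℝ g}
  {h : LieIdeal ℝ g}

/-- A codimension-one ideal orthogonal to the last vector of a frame has the other frame vectors
as a basis. -/
theorem exists_ideal_basis (hdim : Module.finrank ℝ h = 6) (hperp : ∀ y ∈ h, f.repr y 6 = 0) :
    ∃ b : Module.Basis (Fin 6) ℝ h, ∀ i, (b i : g) = f i.castSucc := by
  have hli : LinearIndependent ℝ fun i : Fin 6 => f i.castSucc :=
    f.linearIndependent.comp _ (Fin.castSucc_injective 6)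
  set K : Submodule ℝ g := Submodule.span ℝ (Set.range fun i : Fin 6 => f i.castSucc) with hK
  have hKdim : Module.finrank ℝ K = 6 := by
    rw [hK, finrank_span_eq_card hli, Fintype.card_fin]
  have hle : (h : Submodule ℝ g) ≤ K := by
    intro y hy
    rw [← f.sum_repr y, Fin.sum_univ_castSucc]
    have h0 : f.repr y (Fin.last 6) = 0 := hperp y hy
    rw [h0, zero_smul, add_zero]
    exact Submodule.sum_mem _ fun i _ => Submodule.smul_mem _ _ (Submodule.subset_span ⟨i, rfl⟩)
  have : Module.Finite ℝ K := Module.finite_of_finrank_pos (by omega)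
  have heq : (h : Submodule ℝ g) = K :=
    Submodule.eq_of_le_of_finrank_le hle (hKdim.trans hdim.symm).le
  have hmem : ∀ i : Fin 6, f i.castSucc ∈ h := fun i => by
    have : f i.castSucc ∈ (h : Submodule ℝ g) := heq ▸ Submodule.subset_span ⟨i, rfl⟩
    exact this
  have hli' : LinearIndependent ℝ fun i : Fin 6 => (⟨f i.castSucc, hmem i⟩ : h) :=
    LinearIndependent.of_comp (h : Submodule ℝ g).subtype hli
  exact ⟨basisOfLinearIndependentOfCardEqFinrank hli' (by rw [hdim, Fintype.card_fin]),
    fun i => by rw [coe_basisOfLinearIndependentOfCardEqFinrank]⟩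

variable {b : Module.Basis (Fin 6) ℝ h} (hb : ∀ i, (b i : g) = f i.castSucc)
include hb

theorem repr_castSucc (y : h) (i : Fin 6) : f.repr y i.castSucc = b.repr y i := by
  have hy : (y : g) = ∑ j, b.repr y j • f j.castSucc := by
    let ι : h →ₗ[ℝ] g := ⟨⟨fun z => z, fun _ _ => rfl⟩, fun _ _ => rfl⟩
    change ι y = _
    conv_lhs => rw [← b.sum_repr y, map_sum]
    exact Finset.sum_congr rfl fun j _ => by rw [map_smul, ← hb]; rfl
  rw [hy]
  simp [Finsupp.single_apply]

theorem restrictForm_two (α : g [⋀^Fin 2]→ₗ[ℝ] ℝ) (i j : Fin 6) :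
    restrictForm h α ![b i, b j] = α ![f i.castSucc, f j.castSucc] := by
  rw [restrictForm_apply]
  congr 1
  funext t; fin_cases t <;> exact hb _

theorem restrictForm_three (α : g [⋀^Fin 3]→ₗ[ℝ] ℝ) (i j k : Fin 6) :
    restrictForm h α ![b i, b j, b k] = α ![f i.castSucc, f j.castSucc, f k.castSucc] := by
  rw [restrictForm_apply]
  congr 1
  funext t; fin_cases t <;> exact hb _

theorem restrictForm_four (α : g [⋀^Fin 4]→ₗ[ℝ] ℝ) (i j k l : Fin 6) :
    restrictForm h α ![b i, b j, b k, b l]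
      = α ![f i.castSucc, f j.castSucc, f k.castSucc, f l.castSucc] := by
  rw [restrictForm_apply]
  congr 1
  funext t; fin_cases t <;> exact hb _

theorem inducedOmega_basis (i j : Fin 6) :
    inducedOmega (modelForm f) h (f 6) ![b i, b j] = omegaCoeff i j := by
  rw [inducedOmega, restrictForm_two hb, ← modelCoeff_six, ← modelForm_basis f]
  rfl

theorem restrictForm_model_basis (i j k : Fin 6) :
    restrictForm h (modelForm f) ![b i, b j, b k] = reCoeff i j k := by
  rw [restrictForm_three hb, modelForm_basis, modelCoeff_castSucc]

theorem inducedPsi_basis (i j k : Fin 6) :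
    inducedPsi (hodgeStar f (m := 4) rfl (modelForm f)) h (f 6) ![b i, b j, b k]
      = imCoeff i j k := by
  by_cases hinj : Function.Injective ![i, j, k]
  · obtain ⟨h1, h2⟩ := star_modelCoeff_last i j k hinj
    have h3 := hodgeStar_three_apply f (modelForm f) _ _ _ _ _ _ _ h1
    rw [modelForm_basis, modelCoeff_castSucc, ← Int.cast_mul, h2] at h3
    have hvec : (Matrix.vecCons (f 6) fun t => ((![b i, b j, b k] t : h) : g))
        = ![f 6, f i.castSucc, f j.castSucc, f k.castSucc] := by
      funext t
      fin_cases t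
      · rfl
      all_goals exact hb _
    rw [inducedPsi_apply, hvec, h3]
    push_cast
    ring
  · rw [imCoeff_eq_zero i j k hinj, Int.cast_zero]
    refine AlternatingMap.map_eq_zero_of_not_injective _ _ fun hc => hinj ?_
    have : ![b i, b j, b k] = b ∘ ![i, j, k] := by
      funext t; fin_cases t <;> rfl
    rw [this] at hc
    exact hc.of_comp

/-- The restriction of `⋆φ` to the ideal is `ω ∧ ω / 2`. -/
theorem restrictForm_hodgeStar : restrictForm h (hodgeStar f (m := 4) rfl (modelForm f))
    = halfSquare (inducedOmega (modelForm f) h (f 6)) := by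
  refine ext_alternating_strictMono b fun v hv => ?_
  have hv4 : b ∘ v = ![b (v 0), b (v 1), b (v 2), b (v 3)] := by
    funext t; fin_cases t <;> rfl
  obtain ⟨h1, h2⟩ := star_modelCoeff_four (v 0) (v 1) (v 2) (v 3) (hv (by decide))
    (hv (by decide)) (hv (by decide))
  have h3 := hodgeStar_three_apply f (modelForm f) _ _ _ _ _ _ _ h1
  rw [modelForm_basis, modelCoeff_six, ← Int.cast_mul, h2] at h3
  rw [hv4, halfSquare_apply, restrictForm_four hb, h3]
  simp only [inducedOmega_basis hb]
  push_cast
  rfl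

theorem restrictForm_hodgeStar_extD (hab : ∀ u ∈ h, ∀ v ∈ h, ⁅u, v⁆ = 0)
    (φ : g [⋀^Fin 3]→ₗ[ℝ] ℝ) (i j k : Fin 6) (hij : i < j) (hjk : j < k) :
    restrictForm h (hodgeStar f (m := 3) rfl (extD φ)) ![b i, b j, b k] = complSign i j k *
      formAction (LieModule.toEnd ℝ g h (f 6)) (restrictForm h φ)
        ![b (complIndex [i, j, k] 0), b (complIndex [i, j, k] 1), b (complIndex [i, j, k] 2)] := by
  rw [restrictForm_three hb,
    hodgeStar_four_apply f (extD φ) _ _ _ _ _ _ _ (injective_complIndex i j k hij hjk),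
    ← extD_apply_cons hab, complSign]
  congr 2
  funext t
  fin_cases t
  · rfl
  all_goals exact (hb _).symm

end Frame

end G2Coflow
open G2Coflow in
theorem corollary4p3 {g : Type*} [LieRing g] [LieAlgebra ℝ g]
    (φ : g [⋀^Fin 3]→ₗ[ℝ] ℝ) (e : Module.Basis (Fin 7) ℝ g) (he : IsAdaptedFrame φ e)
    (hco : extD (hodgeStar e (m := 4) rfl φ) = 0)
    (h : LieIdeal ℝ g) (hdim : Module.finrank ℝ h = 6) (hab : ∀ u ∈ h, ∀ v ∈ h, ⁅u, v⁆ = 0)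
    (x : g) (hx : IsUnitNormal e h x)
    (hsol : IsCoflowSoliton e (hodgeStar e (m := 4) rfl φ))
    (heig : IsLaplacianEigenform e (hodgeStar e (m := 4) rfl φ)) :
    laplacian4 e (hodgeStar e (m := 4) rfl φ) = 0 ∧
      MemSU e φ h x (LieModule.toEnd ℝ g h x) := by
  obtain ⟨hx1, hxh⟩ := hx
  obtain ⟨f, hfe, hf6, hf⟩ := exists_adaptedFrame_last e x hx1
  have hφ : φ = modelForm f := he.trans hfe.symm
  clear he hfe hsol
  subst hf6
  have hperp : ∀ y ∈ h, f.repr y 6 = 0 := by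
    intro y hy
    have h1 := hxh y hy
    rw [← frameInner_eq hf] at h1
    simpa [frameInner, Finsupp.single_apply] using h1
  obtain ⟨b, hb⟩ := exists_ideal_basis hdim hperp
  -- The orientation `ε` of `f` drops out, as every condition is homogeneous in the Hodge star.
  set ε := e.det f
  have hε : ε ≠ 0 := fun h0 => by
    have h1 : ε * ε = 1 := basis_det_mul_self hf
    simp [h0] at h1
  have hlap := laplacian4_hodgeStar e φ hco
  have hstar : hodgeStar e (m := 4) rfl φ = ε • hodgeStar f (m := 4) rfl φ :=
    hodgeStar_orthonormal hf _ φ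
  have hres := restrictForm_hodgeStar hb
  rw [← hφ] at hres
  -- The Laplacian of `⋆φ` is exact, so it vanishes on the abelian ideal, but `⋆φ` does not.
  have hzero : laplacian4 e (hodgeStar e (m := 4) rfl φ) = 0 := by
    obtain ⟨-, l, hl⟩ := heig
    have h1 : laplacian4 e (hodgeStar e (m := 4) rfl φ)
        (fun i => ((![b 0, b 1, b 2, b 3] i : h) : g)) = 0 := by
      rw [hlap]
      exact extD_apply_of_mem hab _ _ fun i => Subtype.prop _
    have h2 : hodgeStar f (m := 4) rfl φ (fun i => ((![b 0, b 1, b 2, b 3] i : h) : g)) = 1 := by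
      rw [← restrictForm_apply, hres, halfSquare_apply, hφ]
      simp only [inducedOmega_basis hb]
      norm_num [omegaCoeff]
    rw [hl, hstar, AlternatingMap.smul_apply, AlternatingMap.smul_apply, h2] at h1
    have hl0 : l = 0 := by simpa [hε] using h1
    rw [hl, hl0, zero_smul]
  refine ⟨hzero, ?_⟩
  set A := LieModule.toEnd ℝ g h (f 6) with hA
  set ω := inducedOmega φ h (f 6) with hω
  set ψ := inducedPsi (hodgeStar f (m := 4) rfl φ) h (f 6) with hψ
  set β := restrictForm h (hodgeStar f (k := 4) (m := 3) rfl (extD φ)) with hβ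
  have hωb : ∀ i j, ω ![b i, b j] = omegaCoeff i j := by
    rw [hω, hφ]; exact inducedOmega_basis hb
  have hψb : ∀ i j k, ψ ![b i, b j, b k] = imCoeff i j k := by
    rw [hψ, hφ]; exact inducedPsi_basis hb
  have hρb : ∀ i j k, restrictForm h φ ![b i, b j, b k] = reCoeff i j k := by
    rw [hφ]; exact restrictForm_model_basis hb
  -- Closed forms on `g` restrict to `A`-invariant forms on the ideal.
  have hinv : ∀ {k : ℕ} (α : g [⋀^Fin (k + 1)]→ₗ[ℝ] ℝ), extD (ε • α) = 0 →
      formAction A (restrictForm h α) = 0 := by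
    intro k α hα
    rw [extD_smul] at hα
    have hα' := (smul_eq_zero.mp hα).resolve_left hε
    ext v
    rw [hA, ← extD_apply_cons hab, hα']
    rfl
  have hAω : formAction A ω = 0 := by
    refine formAction_eq_zero_of_halfSquare hωb A ?_
    rw [hω, hφ, ← restrictForm_hodgeStar hb, ← hφ]
    exact hinv _ (hstar ▸ hco)
  have hAβ : formAction A β = 0 := by
    refine hinv _ ?_
    rw [← hodgeStar_orthonormal hf, ← hlap, hzero]
  obtain ⟨B, hB⟩ : ∃ B : Module.End ℝ h, ∀ i j, b.repr (B (b i)) j = b.repr (A (b j)) i :=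
    ⟨b.constr ℝ fun i => ∑ j, b.repr (A (b j)) i • b j, fun i j => by
      simp [Finsupp.single_apply]⟩
  have hBψ : formAction B ψ = 0 :=
    formAction_transpose_eq_zero hB (star_formAction_re hρb hψb
      (restrictForm_hodgeStar_extD hb hab φ) hB (trace_eq_zero_of_symplectic hωb hAω)) hAβ
  have hskew := skew_of_symplectic hωb hψb hB hAω hBψ
  have hBA : A = -B := by
    refine b.ext fun i => b.ext_elem fun j => ?_
    rw [LinearMap.neg_apply, map_neg, Finsupp.neg_apply, hB, hskew]
  have hAψ : formAction A ψ = 0 := by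
    rw [hBA, formAction_neg, hBψ, neg_zero]
  have hinner : ∀ u v : h, frameInner e (u : g) (v : g) = ∑ i, b.repr u i * b.repr v i := by
    intro u v
    rw [← frameInner_eq hf, frameInner, Fin.sum_univ_castSucc]
    have h6 : f.repr (u : g) (Fin.last 6) = 0 := hperp _ u.2
    simp only [Module.Basis.coord_apply, h6, zero_mul, add_zero, repr_castSucc hb]
  refine ⟨fun u v => ?_, hAω, ?_⟩
  · rw [hinner, hinner, ← Finset.sum_neg_distrib]
    have hu := repr_apply_eq_sum b A u
    have hv := repr_apply_eq_sum b A v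
    simp only [hu, hv, Finset.sum_mul, Finset.mul_sum, ← Finset.sum_neg_distrib]
    rw [Finset.sum_comm]
    refine Finset.sum_congr rfl fun i _ => Finset.sum_congr rfl fun j _ => ?_
    rw [hskew j i]
    ring
  · rw [hstar, inducedPsi_smul, formAction_smul, hAψ, smul_zero]
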